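/- Let $\Sigma$ be a locally compact Hausdorff space, $H$ a complex Hilbert space, $\mathcal K=\mathcal K(H)$ the $C^*$-algebra of compact operators on $H$, and $\mathcal E=C_0(\Sigma,\mathcal K)$. A state of a $C^*$-algebra is a positive linear functional of norm one, and a pure state is an extreme point of the set of states; $\mathcal P(\cdot)$ denotes the set of pure states. Let $\mathcal E\otimes_{C_0(\Sigma)}\mathcal E$ be the (Hausdorff) completion, in the maximal $C^*$-seminorm, of the quotient of the algebraic tensor product $\mathcal E\odot\mathcal E$ by the ideal spanned by the elements $fl\otimes g-f\otimes lg$ ($f,g\in\mathcal E$, $l\in C_0(\Sigma)$). A state $\varphi$ of $\mathcal E\otimes_{C_0(\Sigma)}\mathcal E$ is called separable if it is a simple tensor of two states $\varphi_1,\varphi_2$ of $\mathcal E$, that is, $\varphi(f\otimes g)=\varphi_1(f)\varphi_2(g)$ for all $f,g\in\mathcal E$. (i) The pure states of $\mathcal E$ are the pairs $\omega_S=(\omega,\delta_S)$ with $\omega\in\mathcal P(\mathcal K)$ and $S\in\Sigma$, acting by $\omega_S(f)=\omega(f(S))$: the map $(S,\omega)\mapsto\omega_S$ is a bijection from $\Sigma\times\mathcal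 P(\mathcal K)$ onto $\mathcal P(\mathcal E)$. (ii) The separable pure states of $\mathcal E\otimes_{C_0(\Sigma)}\mathcal E$ are exactly the pairs $(\omega_S,\tilde\omega_S)$ of pure states of $\mathcal E$ corresponding to the same point $S\in\Sigma$: there is a bijection from the set of such pairs onto the set of separable pure states of $\mathcal E\otimes_{C_0(\Sigma)}\mathcal E$ which sends $(\omega_S,\tilde\omega_S)$ to the functional $f\otimes g\mapsto\omega_S(f)\,\tilde\omega_S(g)$. (iii) For pure states $\omega_S,\tilde\omega_{\tilde S}$ of $\mathcal E$ corresponding to points $S,\tilde S\in\Sigma$, the functional $\omega_S\otimes\tilde\omega_{\tilde S}$ on $\mathcal E\odot\mathcal E$ induces a bounded linear functional on $\mathcal E\otimes_{C_0(\Sigma)}\mathcal E$ if and only if $S=\tilde S$. -/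

import Mathlib

open scoped TensorProduct ZeroAtInfty ENNReal ComplexOrder InnerProductSpace

universe u v

noncomputable section

/-! ### States and pure states of a (possibly non-unital) C⋆-algebra -/

section States

variable (A : Type u) [NonUnitalCStarAlgebra A]

/-- States: positive linear functionals of norm one. -/
def stateSpace : Set (StrongDual ℂ A) :=
  {φ | (∀ a : A, 0 ≤ φ (star a * a)) ∧ ‖φ‖ = 1}

/-- Pure states: the extreme points of the convex set of states. -/
def pureStates : Set (StrongDual ℂ A) :=
  (stateSpace A).extremePoints ℝ

end States

/-! ### The C⋆-algebra of compact operators on a Hilbert space -/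

section Compact

variable (H : Type v) [NormedAddCommGroup H] [InnerProductSpace ℂ H] [CompleteSpace H]

theorem isCompactOperator_star {H : Type v} [NormedAddCommGroup H] [InnerProductSpace ℂ H]
    [CompleteSpace H] {T : H →L[ℂ] H} (hT : IsCompactOperator T) :
    IsCompactOperator (star T : H →L[ℂ] H) := by
  have hS : IsCompactOperator (T * star T : H →L[ℂ] H) := hT.comp_clm (star T)
  have hK := hS.isCompact_closure_image_closedBall (f := (T * star T : H →L[ℂ] H).toLinearMap) 1
  refine (isCompactOperator_iff_isCompact_closure_image_closedBall
    (star T : H →L[ℂ] H).toLinearMap one_pos).2 ?_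
  refine TotallyBounded.isCompact_of_isClosed (TotallyBounded.closure ?_) isClosed_closure
  have hSb := hK.totallyBounded.subset subset_closure
  rw [Metric.totallyBounded_iff]
  intro ε hε
  obtain ⟨t, hts, htf, ht⟩ := totallyBounded_iff_subset.1 hSb
    {p | dist p.1 p.2 < ε ^ 2 / 2} (Metric.dist_mem_uniformity (by positivity))
  have hts' : ∀ y ∈ t, ∃ x ∈ Metric.closedBall (0 : H) 1, (T * star T : H →L[ℂ] H) x = y :=
    fun y hy => hts hy
  choose! c hc hcS using hts'
  refine ⟨(fun y => (star T : H →L[ℂ] H) (c y)) '' t, htf.image _, ?_⟩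
  rintro _ ⟨x, hx, rfl⟩
  have hmem := ht ⟨x, hx, rfl⟩
  simp only [Set.mem_iUnion] at hmem
  obtain ⟨y, hy, hxy⟩ := hmem
  have hcy := hc y hy
  have hcSy := hcS y hy
  simp only [Set.mem_iUnion, Set.mem_image, exists_prop, exists_exists_and_eq_and]
  refine ⟨y, hy, ?_⟩
  simp only [Set.mem_ofPred_eq] at hxy
  rw [← hcSy] at hxy
  simp only [Metric.mem_ball, dist_eq_norm, ContinuousLinearMap.coe_coe] at hxy ⊢
  rw [← map_sub] at hxy ⊢
  have h1 : ‖x - c y‖ ≤ 2 := by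
    have hx' : ‖x‖ ≤ 1 := by simpa using hx
    have hc' : ‖c y‖ ≤ 1 := by simpa using hcy
    exact (norm_sub_le _ _).trans (by linarith)
  have h2 : ‖(star T : H →L[ℂ] H) (x - c y)‖ ^ 2 ≤
      ‖(T * star T : H →L[ℂ] H) (x - c y)‖ * ‖x - c y‖ := by
    rw [← inner_self_eq_norm_sq (𝕜 := ℂ)]
    have : ⟪(star T : H →L[ℂ] H) (x - c y), (star T : H →L[ℂ] H) (x - c y)⟫_ℂ =
        ⟪(T * star T : H →L[ℂ] H) (x - c y), x - c y⟫_ℂ := by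
      rw [ContinuousLinearMap.star_eq_adjoint, ContinuousLinearMap.adjoint_inner_right]
      rfl
    rw [this]
    exact (RCLike.re_le_norm _).trans (norm_inner_le_norm _ _)
  have h3 : ‖(star T : H →L[ℂ] H) (x - c y)‖ ^ 2 < ε ^ 2 := by
    have := norm_nonneg ((T * star T : H →L[ℂ] H) (x - c y))
    nlinarith
  exact lt_of_pow_lt_pow_left₀ 2 hε.le h3

/-- The compact operators on `H`, as a (non-unital) ⋆-subalgebra of the bounded operators. -/
def compactSubalgebra : NonUnitalStarSubalgebra ℂ (H →L[ℂ] H) where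
  carrier := {T | IsCompactOperator T}
  add_mem' ha hb := IsCompactOperator.add ha hb
  zero_mem' := isCompactOperator_zero
  mul_mem' {_ b} ha _ := IsCompactOperator.comp_clm ha b
  smul_mem' c _ ha := IsCompactOperator.smul ha c
  star_mem' ha := isCompactOperator_star ha

instance isClosed_compactSubalgebra : IsClosed (compactSubalgebra H : Set (H →L[ℂ] H)) :=
  isClosed_setOfPred_isCompactOperator

/-- The C⋆-algebra `𝒦(H)` of compact operators on `H`. -/
def CompactOp : Type v := ↥(compactSubalgebra H)

instance instCompactOp : NonUnitalCStarAlgebra (CompactOp H) :=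
  inferInstanceAs (NonUnitalCStarAlgebra ↥(compactSubalgebra H))

end Compact

/-! ### A bound for ⋆-representations of an algebraic tensor product -/

section Bound

variable {A B : Type u} [NonUnitalCStarAlgebra A] [NonUnitalCStarAlgebra B]
variable {V : Type v} [NormedAddCommGroup V] [InnerProductSpace ℂ V] [CompleteSpace V]

theorem exists_star_mul_self_eq_sub (f a : A) :
    ∃ d : A, star d * d =
      ((‖f‖ ^ 2 : ℝ) : ℂ) • (star a * a) - star (f * a) * (f * a) := by
  let _ := CStarAlgebra.spectralOrder A
  have _ := CStarAlgebra.spectralOrderedRing A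
  have h : star a * (star f * f) * a ≤ ‖star f * f‖ • (star a * a) :=
    CStarAlgebra.star_left_conjugate_le_norm_smul (IsSelfAdjoint.star_mul_self f)
  obtain ⟨d, hd⟩ := CStarAlgebra.nonneg_iff_eq_star_mul_self.1 (sub_nonneg.2 h)
  refine ⟨d, ?_⟩
  rw [← hd, CStarRing.norm_star_mul_self, Complex.coe_smul, ← sq]
  simp only [star_mul, mul_assoc]

theorem norm_sq_tensor_apply (π : A ⊗[ℂ] B →ₙₐ[ℂ] (V →L[ℂ] V))
    (hπ : ∀ a b, π (star a ⊗ₜ star b) = star (π (a ⊗ₜ b))) (a : A) (b : B) (ξ : V) :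
    ‖π (a ⊗ₜ b) ξ‖ ^ 2 = (⟪π ((star a * a) ⊗ₜ (star b * b)) ξ, ξ⟫_ℂ).re := by
  have h : π ((star a * a) ⊗ₜ (star b * b)) = star (π (a ⊗ₜ b)) * π (a ⊗ₜ b) := by
    rw [← hπ, ← map_mul, Algebra.TensorProduct.tmul_mul_tmul]
  rw [h, mul_apply_eq_comp, ContinuousLinearMap.star_eq_adjoint,
    ContinuousLinearMap.adjoint_inner_left]
  exact (inner_self_eq_norm_sq (𝕜 := ℂ) _).symm

theorem norm_tensor_mul_left_apply_le (π : A ⊗[ℂ] B →ₙₐ[ℂ] (V →L[ℂ] V))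
    (hπ : ∀ a b, π (star a ⊗ₜ star b) = star (π (a ⊗ₜ b))) (f a : A) (b : B) (ξ : V) :
    ‖π ((f * a) ⊗ₜ b) ξ‖ ≤ ‖f‖ * ‖π (a ⊗ₜ b) ξ‖ := by
  obtain ⟨d, hd⟩ := exists_star_mul_self_eq_sub f a
  have h := norm_sq_tensor_apply π hπ d b ξ
  rw [hd, TensorProduct.sub_tmul, ← TensorProduct.smul_tmul', map_sub, map_smul,
    sub_apply, smul_apply, inner_sub_left,
    inner_smul_left, Complex.conj_ofReal, Complex.sub_re, Complex.re_ofReal_mul,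
    ← norm_sq_tensor_apply π hπ, ← norm_sq_tensor_apply π hπ] at h
  refine le_of_sq_le_sq ?_ (by positivity)
  nlinarith [sq_nonneg ‖π (d ⊗ₜ b) ξ‖]

theorem norm_tensor_mul_right_apply_le (π : A ⊗[ℂ] B →ₙₐ[ℂ] (V →L[ℂ] V))
    (hπ : ∀ a b, π (star a ⊗ₜ star b) = star (π (a ⊗ₜ b))) (a : A) (g b : B) (ξ : V) :
    ‖π (a ⊗ₜ (g * b)) ξ‖ ≤ ‖g‖ * ‖π (a ⊗ₜ b) ξ‖ := by
  obtain ⟨d, hd⟩ := exists_star_mul_self_eq_sub g b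
  have h := norm_sq_tensor_apply π hπ a d ξ
  rw [hd, TensorProduct.tmul_sub, TensorProduct.tmul_smul, map_sub, map_smul,
    sub_apply, smul_apply, inner_sub_left,
    inner_smul_left, Complex.conj_ofReal, Complex.sub_re, Complex.re_ofReal_mul,
    ← norm_sq_tensor_apply π hπ, ← norm_sq_tensor_apply π hπ] at h
  refine le_of_sq_le_sq ?_ (by positivity)
  nlinarith [sq_nonneg ‖π (a ⊗ₜ d) ξ‖]

/-- Every ⋆-representation of an algebraic tensor product of C⋆-algebras satisfies
`‖π (a ⊗ b)‖ ≤ ‖a‖ ‖b‖`; hence the maximal C⋆-seminorm is finite. -/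
theorem norm_tensor_le (π : A ⊗[ℂ] B →ₙₐ[ℂ] (V →L[ℂ] V))
    (hπ : ∀ a b, π (star a ⊗ₜ star b) = star (π (a ⊗ₜ b))) (a : A) (b : B) :
    ‖π (a ⊗ₜ b)‖ ≤ ‖a‖ * ‖b‖ := by
  set x := π (a ⊗ₜ b) with hx
  have h1 : x * (star x * x) = π ((a * star a * a) ⊗ₜ (b * star b * b)) := by
    rw [hx, ← hπ, ← map_mul, ← map_mul, Algebra.TensorProduct.tmul_mul_tmul,
      Algebra.TensorProduct.tmul_mul_tmul, mul_assoc a, mul_assoc b]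
  have h2 : ‖x * (star x * x)‖ ≤ (‖a‖ * ‖a‖) * ((‖b‖ * ‖b‖) * ‖x‖) := by
    refine ContinuousLinearMap.opNorm_le_bound _ (by positivity) fun ξ => ?_
    rw [h1]
    calc ‖π ((a * star a * a) ⊗ₜ (b * star b * b)) ξ‖
        ≤ ‖a * star a‖ * ‖π (a ⊗ₜ (b * star b * b)) ξ‖ :=
          norm_tensor_mul_left_apply_le π hπ _ _ _ _
      _ ≤ ‖a * star a‖ * (‖b * star b‖ * ‖π (a ⊗ₜ b) ξ‖) := by
          gcongr
          exact norm_tensor_mul_right_apply_le π hπ _ _ _ _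
      _ ≤ (‖a‖ * ‖a‖) * ((‖b‖ * ‖b‖) * (‖x‖ * ‖ξ‖)) := by
          rw [CStarRing.norm_self_mul_star, CStarRing.norm_self_mul_star]
          gcongr
          exact x.le_opNorm ξ
      _ = (‖a‖ * ‖a‖) * ((‖b‖ * ‖b‖) * ‖x‖) * ‖ξ‖ := by ring
  have h3 : ‖x‖ * ‖x‖ * (‖x‖ * ‖x‖) = ‖star x * (x * (star x * x))‖ := by
    have e : star x * (x * (star x * x)) = star (star x * x) * (star x * x) := by
      simp only [star_mul, star_star, mul_assoc]
    rw [e, CStarRing.norm_star_mul_self, CStarRing.norm_star_mul_self]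
  have h4 : ‖x‖ * ‖x‖ * (‖x‖ * ‖x‖) ≤ ‖x‖ * ((‖a‖ * ‖a‖) * ((‖b‖ * ‖b‖) * ‖x‖)) := by
    rw [h3]
    refine (norm_mul_le _ _).trans ?_
    rw [norm_star]
    gcongr
  rcases (norm_nonneg x).eq_or_lt with h0 | h0
  · rw [← h0]; positivity
  · refine le_of_sq_le_sq ?_ (by positivity)
    have h5 : (‖x‖ * ‖x‖) * (‖x‖ ^ 2) ≤ (‖x‖ * ‖x‖) * ((‖a‖ * ‖b‖) ^ 2) := by nlinarith
    exact le_of_mul_le_mul_left h5 (by positivity)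

end Bound

/-! ### Balanced tensor products -/

section Balanced

variable {A : Type u} [NonUnitalCStarAlgebra A] {Z : Type v} (act : Z → A → A)

/-- A ⋆-representation on a Hilbert space of the algebraic tensor product `A ⊙ A` which vanishes
on all `l f ⊗ g - f ⊗ l g`, where `l` runs through `Z` acting on `A` by `act`: that is, a
⋆-representation of the quotient of `A ⊙ A` by the balancing ideal.  Since `A ⊙ A` lives in the
universe `u`, every C⋆-seminorm on the quotient is the norm of such a representation. -/
structure BalancedRep where
  /-- the Hilbert space of the representation -/
  V : Type u
  [normed : NormedAddCommGroup V]
  [inner : InnerProductSpace ℂ V]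
  [complete : CompleteSpace V]
  /-- the representation, linear and multiplicative -/
  π : A ⊗[ℂ] A →ₙₐ[ℂ] (V →L[ℂ] V)
  map_star' : ∀ f g : A, π (star f ⊗ₜ star g) = star (π (f ⊗ₜ g))
  balanced' : ∀ (l : Z) (f g : A), π (act l f ⊗ₜ g) = π (f ⊗ₜ act l g)

attribute [instance] BalancedRep.normed BalancedRep.inner BalancedRep.complete

/-- The `ℓ^∞`-product of the operator algebras of all balanced representations. -/
abbrev BalancedProd : Type (u + 1) :=
  lp (fun i : BalancedRep act => (i.V →L[ℂ] i.V)) ∞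

theorem memℓp_balanced (t : A ⊗[ℂ] A) :
    Memℓp (fun i : BalancedRep act => i.π t) ∞ := by
  refine memℓp_infty ?_
  suffices h : ∃ C : ℝ, ∀ i : BalancedRep act, ‖i.π t‖ ≤ C by
    obtain ⟨C, hC⟩ := h
    exact ⟨C, by rintro _ ⟨i, rfl⟩; exact hC i⟩
  induction t with
  | zero => exact ⟨0, fun i => by rw [map_zero, norm_zero]⟩
  | tmul f g => exact ⟨‖f‖ * ‖g‖, fun i => norm_tensor_le i.π i.map_star' f g⟩
  | add s t hs ht =>
    obtain ⟨C, hC⟩ := hs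
    obtain ⟨D, hD⟩ := ht
    exact ⟨C + D, fun i => by
      rw [map_add]
      exact (norm_add_le _ _).trans (add_le_add (hC i) (hD i))⟩

/-- The universal balanced representation `t ↦ (π_i t)_i`; the norm of the image of `t` is the
maximal C⋆-seminorm of the class of `t` in the quotient of `A ⊙ A`. -/
def universalRep : A ⊗[ℂ] A →ₙₐ[ℂ] BalancedProd act where
  toFun t := ⟨fun i => i.π t, memℓp_balanced act t⟩
  map_smul' c t := by
    apply Subtype.ext; funext i; exact map_smul i.π c t
  map_zero' := by
    apply Subtype.ext; funext i; exact map_zero i.π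
  map_add' s t := by
    apply Subtype.ext; funext i; exact map_add i.π s t
  map_mul' s t := by
    apply Subtype.ext; funext i; exact map_mul i.π s t

theorem universalRep_star_tmul (f g : A) :
    universalRep act (star f ⊗ₜ star g) = star (universalRep act (f ⊗ₜ g)) := by
  apply Subtype.ext
  funext i
  exact i.map_star' f g

theorem star_universalRep_mem_range (t : A ⊗[ℂ] A) :
    ∃ s, universalRep act s = star (universalRep act t) := by
  induction t with
  | zero => exact ⟨0, by rw [map_zero, star_zero]⟩
  | tmul f g => exact ⟨star f ⊗ₜ star g, universalRep_star_tmul act f g⟩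
  | add s t hs ht =>
    obtain ⟨s', hs'⟩ := hs
    obtain ⟨t', ht'⟩ := ht
    exact ⟨s' + t', by rw [map_add, map_add, star_add, hs', ht']⟩

/-- The image of `A ⊙ A` under the universal balanced representation. -/
def algebraicBalanced : NonUnitalStarSubalgebra ℂ (BalancedProd act) where
  toNonUnitalSubalgebra := NonUnitalAlgHom.range (universalRep act)
  star_mem' := by
    rintro _ ⟨t, rfl⟩
    obtain ⟨s, hs⟩ := star_universalRep_mem_range act t
    exact ⟨s, hs⟩

/-- The closure of that image: the (Hausdorff) completion of the quotient of `A ⊙ A` by the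
balancing ideal in the maximal C⋆-seminorm. -/
def balancedSubalgebra : NonUnitalStarSubalgebra ℂ (BalancedProd act) :=
  (algebraicBalanced act).topologicalClosure

instance isClosed_balancedSubalgebra :
    IsClosed (balancedSubalgebra act : Set (BalancedProd act)) :=
  (algebraicBalanced act).isClosed_topologicalClosure

/-- The balanced tensor product C⋆-algebra of `A` with itself. -/
def BalancedTensor : Type (u + 1) := ↥(balancedSubalgebra act)

instance instBalancedTensor : NonUnitalCStarAlgebra (BalancedTensor act) :=
  inferInstanceAs (NonUnitalCStarAlgebra ↥(balancedSubalgebra act))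

/-- The image of an elementary tensor `f ⊗ g` in the balanced tensor product. -/
def balancedTmul (f g : A) : BalancedTensor act :=
  ⟨universalRep act (f ⊗ₜ g),
    (algebraicBalanced act).le_topologicalClosure ⟨f ⊗ₜ g, rfl⟩⟩

variable {act}

/-- `φ` is the functional induced by `φ₁ ⊗ φ₂` on the balanced tensor product. -/
def IsTensorOf (φ : StrongDual ℂ (BalancedTensor act)) (φ₁ φ₂ : StrongDual ℂ A) : Prop :=
  ∀ f g : A, φ (balancedTmul act f g) = φ₁ f * φ₂ g

/-- `φ` is separable: a simple tensor of two states. -/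
def IsSeparableState (φ : StrongDual ℂ (BalancedTensor act)) : Prop :=
  ∃ φ₁ ∈ stateSpace A, ∃ φ₂ ∈ stateSpace A, IsTensorOf φ φ₁ φ₂

end Balanced

/-! ### The C⋆-algebra `E = C₀(X, 𝒦(H))` and its balanced tensor square -/

section Fields

variable (X : Type u) [TopologicalSpace X]
variable (H : Type v) [NormedAddCommGroup H] [InnerProductSpace ℂ H] [CompleteSpace H]

/-- `C₀(X, 𝒦(H))` with pointwise operations and the supremum norm. -/
abbrev CompactField : Type (max u v) := C₀(X, CompactOp H)

variable {X H}

/-- The central action of `C₀(X)` on `C₀(X, 𝒦(H))`: `(l f)(x) = l(x) f(x)`. -/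
def centralMul (l : C₀(X, ℂ)) (f : CompactField X H) : CompactField X H where
  toFun x := l x • f x
  continuous_toFun := (map_continuous l).smul (map_continuous f)
  zero_at_infty' := by
    simpa using (zero_at_infty l).smul (zero_at_infty f)

/-- Evaluation at a point, as a continuous linear map `C₀(X, 𝒦(H)) → 𝒦(H)`. -/
def evalAt (S : X) : CompactField X H →L[ℂ] CompactOp H :=
  LinearMap.mkContinuous
    { toFun := fun f : CompactField X H => f S
      map_add' := fun _ _ => rfl
      map_smul' := fun _ _ => rfl } 1 fun f => by
    rw [one_mul]
    exact f.toBCF.norm_coe_le_norm S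

/-- The functional `ω_S = (ω, δ_S) : f ↦ ω (f S)` on `C₀(X, 𝒦(H))`. -/
def fiberState (S : X) (ω : StrongDual ℂ (CompactOp H)) : StrongDual ℂ (CompactField X H) :=
  ω.comp (evalAt S)

/-- `φ` corresponds to the point `S`: it is `(ω, δ_S)` for a pure state `ω` of `𝒦(H)`. -/
def LiesOver (φ : StrongDual ℂ (CompactField X H)) (S : X) : Prop :=
  ∃ ω ∈ pureStates (CompactOp H), φ = fiberState S ω

variable (X H)

/-- The C⋆-algebra `E ⊗_{C₀(X)} E` for `E = C₀(X, 𝒦(H))`. -/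
abbrev BalancedSquare : Type (max u v + 1) :=
  BalancedTensor (centralMul : C₀(X, ℂ) → CompactField X H → CompactField X H)

end Fields

end

/-! Everything rests on a Schur-type principle: a positive functional dominated by a multiple of a
pure state is itself a multiple of that state (`pureStates.exists_eq_smul_of_le`). It follows from
extremality because norms of positive functionals add.

Let φ be a pure state of `C₀(X, 𝒦(H))`. For l ≥ 0 in `C₀(X)` the functional f ↦ φ(l f) is positive
and dominated by a multiple of φ. Hence `C₀(X)` acts on φ through a character, which is evaluation
at a point S, and φ factors through the fibre at S. Conversely, the states over S form a face of the
state space, so purity can be tested in the fibre. This gives (i).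

If φ₁ ⊗ φ₂ descends to the balanced product, then φ₁(l f) φ₂(g) = φ₁(f) φ₂(l g). Separating
variables, `C₀(X)` acts on both factors by one and the same character, so the two states, pure or
not, lie over a common point (`IsTensorOf.exists_eq_fiberState`). For pure states over different
points this relation is contradictory.

Conversely, for two states over S each l acts as the scalar l(S) in both GNS representations. Their
Hilbert space tensor product is therefore a balanced representation, and the vector ξ₁ ⊗ ξ₂
implements the product state. Purity passes from the factors to the product by applying the
domination principle to slices, and back by decomposing one factor with the other held fixed. The
factors are determined by the product (`IsTensorOf.unique`), which gives the bijection in (ii). -/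

section PositiveFunctionals

/-! ### Positive functionals, norms and domination by pure states -/

variable {A : Type u} [NonUnitalCStarAlgebra A]

/-- Positivity of a bounded linear functional on a C⋆-algebra. -/
def IsPositiveFunctional (φ : StrongDual ℂ A) : Prop :=
  ∀ a : A, 0 ≤ φ (star a * a)

/-- A positive bounded functional, bundled as a positive linear map for the spectral order. -/
noncomputable def IsPositiveFunctional.toPositiveLinearMap {φ : StrongDual ℂ A}
    (hφ : IsPositiveFunctional φ) :
    letI := CStarAlgebra.spectralOrder A
    A →ₚ[ℂ] ℂ :=
  letI := CStarAlgebra.spectralOrder A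
  haveI := CStarAlgebra.spectralOrderedRing A
  PositiveLinearMap.mk₀ φ.toLinearMap fun x hx => by
    obtain ⟨d, rfl⟩ := CStarAlgebra.nonneg_iff_eq_star_mul_self.1 hx
    exact hφ d

namespace IsPositiveFunctional

theorem re_nonneg {φ : StrongDual ℂ A} (hφ : IsPositiveFunctional φ) (a : A) :
    0 ≤ (φ (star a * a)).re := (Complex.le_def.1 (hφ a)).1

theorem ofReal_re {φ : StrongDual ℂ A} (hφ : IsPositiveFunctional φ) (a : A) :
    ((φ (star a * a)).re : ℂ) = φ (star a * a) :=
  Complex.ext rfl (Complex.le_def.1 (hφ a)).2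

theorem add {φ ψ : StrongDual ℂ A} (hφ : IsPositiveFunctional φ) (hψ : IsPositiveFunctional ψ) :
    IsPositiveFunctional (φ + ψ) := fun a => add_nonneg (hφ a) (hψ a)

theorem smul {φ : StrongDual ℂ A} (hφ : IsPositiveFunctional φ) {c : ℝ} (hc : 0 ≤ c) :
    IsPositiveFunctional (c • φ) := fun a => by
  rw [smul_apply, Complex.real_smul]
  exact mul_nonneg (Complex.zero_le_real.2 hc) (hφ a)

/-- The Cauchy–Schwarz inequality. -/
theorem norm_sq_apply_star_mul_le {φ : StrongDual ℂ A} (hφ : IsPositiveFunctional φ) (a b : A) :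
    ‖φ (star a * b)‖ ^ 2 ≤ (φ (star a * a)).re * (φ (star b * b)).re := by
  let _ := CStarAlgebra.spectralOrder A
  have _ := CStarAlgebra.spectralOrderedRing A
  set f := hφ.toPositiveLinearMap
  have h := norm_inner_le_norm (𝕜 := ℂ) (f.toPreGNS a) (f.toPreGNS b)
  have hn : ∀ c, ‖f.toPreGNS c‖ ^ 2 = (φ (star c * c)).re := fun c => by
    have := f.preGNS_norm_sq (f.toPreGNS c)
    have h2 : ((‖f.toPreGNS c‖ ^ 2 : ℝ) : ℂ) = φ (star c * c) := by
      rw [Complex.ofReal_pow]; exact this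
    rw [← h2, Complex.ofReal_re]
  rw [← hn a, ← hn b, ← mul_pow]
  exact pow_le_pow_left₀ (norm_nonneg _) h 2

/-- The norm of a positive functional is its limit along the canonical approximate unit. -/
theorem tendsto_approximateUnit {φ : StrongDual ℂ A} (hφ : IsPositiveFunctional φ) :
    letI := CStarAlgebra.spectralOrder A
    haveI := CStarAlgebra.spectralOrderedRing A
    Filter.Tendsto (fun e => (φ e).re) (CStarAlgebra.approximateUnit A) (nhds ‖φ‖) := by
  let _ := CStarAlgebra.spectralOrder A
  have _ := CStarAlgebra.spectralOrderedRing A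
  have hu := CStarAlgebra.increasingApproximateUnit (A := A)
  have hre : ∀ᶠ e in CStarAlgebra.approximateUnit A, 0 ≤ (φ e).re := by
    filter_upwards [hu.eventually_nonneg] with e he
    obtain ⟨d, rfl⟩ := CStarAlgebra.nonneg_iff_eq_star_mul_self.1 he
    exact hφ.re_nonneg d
  refine tendsto_order.2 ⟨fun c hc => ?_, fun c hc => ?_⟩
  · rcases lt_or_ge c 0 with h0 | h0
    · filter_upwards [hre] with e he using h0.trans_le he
    have hpos : 0 < ‖φ‖ := h0.trans_lt hc
    -- The threshold is set so that |φ(e x)|² eventually exceeds c‖φ‖. Writing e = d*d,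
    -- Cauchy–Schwarz bounds the same quantity by φ(e) φ(x* e x) ≤ φ(e)‖φ‖, and cancelling ‖φ‖
    -- leaves c < φ(e).
    have h1 : √(c * ‖φ‖) < ‖φ‖ := by
      rw [Real.sqrt_lt' hpos, sq]
      exact mul_lt_mul_of_pos_right hc hpos
    obtain ⟨x, hx, hxc⟩ := φ.exists_lt_apply_of_lt_opNorm h1
    have h2 : c * ‖φ‖ < ‖φ x‖ ^ 2 := Real.lt_sq_of_sqrt_lt hxc
    have ht : Filter.Tendsto (fun e => ‖φ (e * x)‖ ^ 2) (CStarAlgebra.approximateUnit A)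
        (nhds (‖φ x‖ ^ 2)) :=
      (((φ.continuous.tendsto x).comp (hu.tendsto_mul_right x)).norm).pow 2
    filter_upwards [(tendsto_order.1 ht).1 _ h2, hu.eventually_nonneg, hu.eventually_norm, hre]
      with e he h3 h4 h5
    obtain ⟨d, hd⟩ := CStarAlgebra.nonneg_iff_eq_star_mul_self.1 h3
    have h6 := hφ.norm_sq_apply_star_mul_le d (d * x)
    rw [← mul_assoc, ← hd] at h6
    have h7 : (φ (star (d * x) * (d * x))).re ≤ ‖φ‖ := by
      have h8 : star (d * x) * (d * x) = star x * e * x := by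
        rw [hd]; simp only [star_mul, mul_assoc]
      refine (Complex.re_le_norm _).trans ((φ.le_opNorm _).trans ?_)
      refine mul_le_of_le_one_right hpos.le ?_
      rw [h8]
      calc ‖star x * e * x‖ ≤ ‖star x‖ * ‖e‖ * ‖x‖ :=
            (norm_mul_le _ _).trans (mul_le_mul_of_nonneg_right (norm_mul_le _ _) (norm_nonneg _))
        _ ≤ 1 * 1 * 1 := by
            rw [norm_star]
            gcongr
        _ = 1 := by norm_num
    have h9 : c * ‖φ‖ < (φ e).re * ‖φ‖ :=
      he.trans_le (h6.trans (mul_le_mul_of_nonneg_left h7 h5))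
    exact lt_of_mul_lt_mul_right h9 hpos.le
  · filter_upwards [hu.eventually_norm] with e he
    exact ((Complex.re_le_norm _).trans ((φ.le_opNorm e).trans
      (mul_le_of_le_one_right (norm_nonneg _) he))).trans_lt hc

/-- Both norms are limits along the same approximate unit, where evaluation is additive. This makes
the weights of a positive decomposition of a state sum to one. -/
theorem norm_add {φ ψ : StrongDual ℂ A} (hφ : IsPositiveFunctional φ)
    (hψ : IsPositiveFunctional ψ) : ‖φ + ψ‖ = ‖φ‖ + ‖ψ‖ := by
  let _ := CStarAlgebra.spectralOrder A
  have _ := CStarAlgebra.spectralOrderedRing A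
  exact tendsto_nhds_unique (hφ.add hψ).tendsto_approximateUnit
    (hφ.tendsto_approximateUnit.add hψ.tendsto_approximateUnit)

/-- Cauchy–Schwarz with an approximate unit standing in for the missing unit: φ(e e*) ≤ ‖φ‖ and e a
→ a. -/
theorem norm_sq_apply_le {φ : StrongDual ℂ A} (hφ : IsPositiveFunctional φ) (a : A) :
    ‖φ a‖ ^ 2 ≤ ‖φ‖ * (φ (star a * a)).re := by
  let _ := CStarAlgebra.spectralOrder A
  have _ := CStarAlgebra.spectralOrderedRing A
  have hu := CStarAlgebra.increasingApproximateUnit (A := A)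
  refine le_of_tendsto ((((φ.continuous.tendsto a).comp (hu.tendsto_mul_right a)).norm).pow 2) ?_
  filter_upwards [hu.eventually_norm] with e he
  have h := hφ.norm_sq_apply_star_mul_le (star e) a
  rw [star_star] at h
  refine h.trans (mul_le_mul_of_nonneg_right ?_ (hφ.re_nonneg a))
  refine (Complex.re_le_norm _).trans ((φ.le_opNorm _).trans
    (mul_le_of_le_one_right (norm_nonneg _) ?_))
  rw [CStarRing.norm_self_mul_star]
  exact mul_le_one₀ he (norm_nonneg _) he

end IsPositiveFunctional

theorem stateSpace.isPositiveFunctional {φ : StrongDual ℂ A} (hφ : φ ∈ stateSpace A) :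
    IsPositiveFunctional φ := hφ.1

theorem stateSpace.exists_apply_ne_zero {φ : StrongDual ℂ A} (hφ : φ ∈ stateSpace A) :
    ∃ a, φ a ≠ 0 := by
  by_contra! h
  have : φ = 0 := ContinuousLinearMap.ext h
  have h1 := hφ.2
  rw [this, norm_zero] at h1
  exact zero_ne_one h1

theorem IsPositiveFunctional.inv_norm_smul_mem_stateSpace {φ : StrongDual ℂ A}
    (hφ : IsPositiveFunctional φ) (h : φ ≠ 0) : ‖φ‖⁻¹ • φ ∈ stateSpace A := by
  refine ⟨hφ.smul (inv_nonneg.2 (norm_nonneg _)), ?_⟩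
  rw [norm_smul, norm_inv, norm_norm, inv_mul_cancel₀ (norm_ne_zero_iff.2 h)]

/-- If `φ` is pure and splits as a sum of positive functionals, these are multiples of `φ`. -/
theorem pureStates.eq_norm_smul_of_add {φ ψ χ : StrongDual ℂ A} (hφ : φ ∈ pureStates A)
    (hψ : IsPositiveFunctional ψ) (hχ : IsPositiveFunctional χ) (h : ψ + χ = φ) :
    ψ = ‖ψ‖ • φ := by
  rcases eq_or_ne ψ 0 with rfl | hψ0
  · rw [norm_zero]
    exact (zero_smul ℝ φ).symm
  rcases eq_or_ne χ 0 with rfl | hχ0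
  · rw [add_zero] at h
    rw [h, hφ.1.2, one_smul]
  -- The norms are the weights that exhibit φ as a convex combination of the normalised ψ and χ.
  have hn : ‖ψ‖ + ‖χ‖ = 1 := by rw [← hψ.norm_add hχ, h, hφ.1.2]
  have h1 : φ ∈ openSegment ℝ (‖ψ‖⁻¹ • ψ) (‖χ‖⁻¹ • χ) :=
    ⟨‖ψ‖, ‖χ‖, norm_pos_iff.2 hψ0, norm_pos_iff.2 hχ0, hn, by
      rw [smul_inv_smul₀ (norm_ne_zero_iff.2 hψ0), smul_inv_smul₀ (norm_ne_zero_iff.2 hχ0), h]⟩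
  have h2 := hφ.2 (hψ.inv_norm_smul_mem_stateSpace hψ0) (hχ.inv_norm_smul_mem_stateSpace hχ0) h1
  rw [← h2, smul_inv_smul₀ (norm_ne_zero_iff.2 hψ0)]

/-- A positive functional dominated by a multiple of a pure state is a multiple of it. -/
theorem pureStates.exists_eq_smul_of_le {φ ψ : StrongDual ℂ A} (hφ : φ ∈ pureStates A)
    (hψ : IsPositiveFunctional ψ) {c : ℝ}
    (h : ∀ a, (ψ (star a * a)).re ≤ c * (φ (star a * a)).re) :
    ∃ r : ℝ, 0 ≤ r ∧ ψ = r • φ := by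
  have hφp := stateSpace.isPositiveFunctional hφ.1
  -- The maximum keeps the constant invertible whatever the sign of c; then d⁻¹ψ and φ − d⁻¹ψ are
  -- positive with sum φ.
  set d : ℝ := max c 1
  have hd : 0 < d := lt_max_of_lt_right one_pos
  have hle : IsPositiveFunctional (φ - d⁻¹ • ψ) := fun a => by
    rw [sub_apply, smul_apply, ← hφp.ofReal_re, ← hψ.ofReal_re, Complex.real_smul,
      ← Complex.ofReal_mul, ← Complex.ofReal_sub, Complex.zero_le_real, sub_nonneg,
      inv_mul_le_iff₀ hd]
    exact (h a).trans (mul_le_mul_of_nonneg_right (le_max_left _ _) (hφp.re_nonneg a))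
  have h1 := pureStates.eq_norm_smul_of_add hφ (hψ.smul (inv_nonneg.2 hd.le)) hle (add_sub_cancel _ _)
  refine ⟨d * ‖d⁻¹ • ψ‖, by positivity, ?_⟩
  rw [mul_smul, ← h1, smul_inv_smul₀ hd.ne']

end PositiveFunctionals

/-! ### GNS representations and their Hilbert space tensor products -/

section Representations

variable {A : Type u} [NonUnitalCStarAlgebra A]

open UniformSpace Completion in
/-- The GNS construction with its cyclic vector, for possibly non-unital C⋆-algebras. -/
theorem IsPositiveFunctional.exists_gns {φ : StrongDual ℂ A} (hφ : IsPositiveFunctional φ) :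
    ∃ (V : Type u) (_ : NormedAddCommGroup V) (_ : InnerProductSpace ℂ V) (_ : CompleteSpace V)
      (π : A →⋆ₙₐ[ℂ] (V →L[ℂ] V)) (ξ : V), (∀ a, ⟪ξ, π a ξ⟫_ℂ = φ a) ∧ ‖ξ‖ ^ 2 ≤ ‖φ‖ ∧
      ∀ a, (∀ b, φ (star (a * b) * (a * b)) = 0) → π a = 0 := by
  let _ := CStarAlgebra.spectralOrder A
  have _ := CStarAlgebra.spectralOrderedRing A
  set f := hφ.toPositiveLinearMap with hf
  have hn : ∀ c : f.PreGNS, ‖c‖ ^ 2 = (φ (star (f.ofPreGNS c) * f.ofPreGNS c)).re := fun c => by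
    have h2 : ((‖c‖ ^ 2 : ℝ) : ℂ) = φ (star (f.ofPreGNS c) * f.ofPreGNS c) := by
      rw [Complex.ofReal_pow]; exact f.preGNS_norm_sq c
    rw [← h2, Complex.ofReal_re]
  have hb : ∀ c : f.PreGNS, ‖φ (f.ofPreGNS c)‖ ≤ √‖φ‖ * ‖c‖ := fun c => by
    refine le_of_sq_le_sq ?_ (by positivity)
    rw [mul_pow, Real.sq_sqrt (norm_nonneg _), hn]
    exact hφ.norm_sq_apply_le _
  -- There is no unit whose class could serve as the cyclic vector. Instead φ is bounded by √‖φ‖ in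
  -- the GNS seminorm, and ξ is the Riesz vector of its extension to the completion.
  let g : f.PreGNS →L[ℂ] ℂ :=
    (φ.toLinearMap ∘ₗ f.ofPreGNS.toLinearMap).mkContinuous (√‖φ‖) hb
  let G : f.GNS →L[ℂ] ℂ := g.fromCompletion
  have hG : ∀ c : f.PreGNS, G c = φ (f.ofPreGNS c) := fun c => g.fromCompletion_apply_coe c
  set ξ := (InnerProductSpace.toDual ℂ f.GNS).symm G with hξ
  have hξa : ∀ a : A, ⟪ξ, ((f.toPreGNS a : f.PreGNS) : f.GNS)⟫_ℂ = φ a := fun a => by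
    rw [hξ, InnerProductSpace.toDual_symm_apply, hG, f.ofPreGNS_toPreGNS]
  -- Tested against the dense classes of elements v, moving π(a) across the inner product reduces
  -- this to ⟨ξ, a* v⟩ = φ(a* v).
  have hπξ : ∀ a : A, f.gnsNonUnitalStarAlgHom a ξ = ((f.toPreGNS a : f.PreGNS) : f.GNS) := by
    intro a
    refine ext_inner_right ℂ fun v => ?_
    induction v using induction_on with
    | hp => apply isClosed_eq <;> fun_prop
    | ih v =>
      rw [← ContinuousLinearMap.adjoint_inner_right, ← ContinuousLinearMap.star_eq_adjoint,
        ← StarHomClass.map_star, f.gnsNonUnitalStarAlgHom_apply_coe, inner_coe,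
        f.preGNS_inner_def]
      exact hξa _
  refine ⟨f.GNS, inferInstance, inferInstance, inferInstance, f.gnsNonUnitalStarAlgHom, ξ,
    fun a => by rw [hπξ, hξa], ?_, fun a ha => ?_⟩
  · have h1 : ‖ξ‖ ≤ √‖φ‖ := by
      rw [hξ, LinearIsometryEquiv.norm_map]
      refine G.opNorm_le_bound (Real.sqrt_nonneg _) fun v => ?_
      induction v using induction_on with
      | hp => exact isClosed_le (by fun_prop) (by fun_prop)
      | ih v => rw [hG, norm_coe]; exact hb v
    calc ‖ξ‖ ^ 2 ≤ √‖φ‖ ^ 2 := by gcongr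
      _ = ‖φ‖ := Real.sq_sqrt (norm_nonneg _)
  -- On the dense subspace, π(a) sends the class of b to that of a b, whose squared norm vanishes by
  -- hypothesis.
  · ext v
    induction v using induction_on with
    | hp => exact isClosed_eq (by fun_prop) (by fun_prop)
    | ih v =>
      rw [f.gnsNonUnitalStarAlgHom_apply_coe, zero_apply, ← norm_eq_zero, norm_coe,
        ← sq_eq_zero_iff, hn]
      exact congrArg Complex.re (ha (f.ofPreGNS v))

variable {V₁ V₂ : Type u} [NormedAddCommGroup V₁] [InnerProductSpace ℂ V₁]
  [NormedAddCommGroup V₂] [InnerProductSpace ℂ V₂]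

section Completion

open UniformSpace Completion

variable {W : Type v} [NormedAddCommGroup W] [InnerProductSpace ℂ W]

theorem ContinuousLinearMap.completion_add (S T : W →L[ℂ] W) :
    (S + T).completion = S.completion + T.completion := by
  ext v
  induction v using induction_on with
  | hp => exact isClosed_eq (ContinuousLinearMap.continuous _) (ContinuousLinearMap.continuous _)
  | ih v => simp only [add_apply, ContinuousLinearMap.completion_apply_coe, coe_add]

theorem ContinuousLinearMap.completion_smul (c : ℂ) (S : W →L[ℂ] W) :
    (c • S).completion = c • S.completion := by
  ext v
  induction v using induction_on with
  | hp => exact isClosed_eq (ContinuousLinearMap.continuous _) (ContinuousLinearMap.continuous _)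
  | ih v => simp only [smul_apply, ContinuousLinearMap.completion_apply_coe, coe_smul]

end Completion

open UniformSpace Completion in
/-- The operator `S ⊗ T` on the Hilbert space tensor product, bilinear in `S` and `T`. -/
noncomputable def hilbertTensorOp : (V₁ →L[ℂ] V₁) →ₗ[ℂ] (V₂ →L[ℂ] V₂) →ₗ[ℂ]
    (Completion (V₁ ⊗[ℂ] V₂) →L[ℂ] Completion (V₁ ⊗[ℂ] V₂)) :=
  LinearMap.mk₂ ℂ (fun S T => (TensorProduct.mapL S T).completion)
    (fun S S' T => by
      rw [TensorProduct.mapL_add_left, ContinuousLinearMap.completion_add])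
    (fun c S T => by
      rw [TensorProduct.mapL_smul_left, ContinuousLinearMap.completion_smul])
    (fun S T T' => by
      rw [TensorProduct.mapL_add_right, ContinuousLinearMap.completion_add])
    (fun c S T => by
      rw [TensorProduct.mapL_smul_right, ContinuousLinearMap.completion_smul])

open UniformSpace Completion in
theorem hilbertTensorOp_apply_coe (S : V₁ →L[ℂ] V₁) (T : V₂ →L[ℂ] V₂) (v : V₁ ⊗[ℂ] V₂) :
    hilbertTensorOp S T (v : Completion (V₁ ⊗[ℂ] V₂)) = (TensorProduct.mapL S T v : V₁ ⊗[ℂ] V₂) :=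
  (TensorProduct.mapL S T).completion_apply_coe v

open UniformSpace Completion in
theorem hilbertTensorOp_mul (S S' : V₁ →L[ℂ] V₁) (T T' : V₂ →L[ℂ] V₂) :
    hilbertTensorOp (S * S') (T * T') = hilbertTensorOp S T * hilbertTensorOp S' T' := by
  ext v
  induction v using induction_on with
  | hp => exact isClosed_eq (by fun_prop) (by fun_prop)
  | ih v =>
    rw [mul_apply_eq_comp, hilbertTensorOp_apply_coe, hilbertTensorOp_apply_coe,
      hilbertTensorOp_apply_coe, TensorProduct.mapL_mul]
    rfl

variable [CompleteSpace V₁] [CompleteSpace V₂]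

theorem inner_mapL_star (S : V₁ →L[ℂ] V₁) (T : V₂ →L[ℂ] V₂) (v w : V₁ ⊗[ℂ] V₂) :
    ⟪TensorProduct.mapL (star S) (star T) v, w⟫_ℂ = ⟪v, TensorProduct.mapL S T w⟫_ℂ := by
  induction v with
  | zero => simp
  | add v v' h h' => rw [map_add, inner_add_left, inner_add_left, h, h']
  | tmul x y =>
    induction w with
    | zero => simp
    | add w w' h h' => rw [map_add, inner_add_right, inner_add_right, h, h']
    | tmul x' y' =>
      rw [TensorProduct.mapL_tmul, TensorProduct.mapL_tmul, TensorProduct.inner_tmul,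
        TensorProduct.inner_tmul, ContinuousLinearMap.star_eq_adjoint,
        ContinuousLinearMap.star_eq_adjoint, ContinuousLinearMap.adjoint_inner_left,
        ContinuousLinearMap.adjoint_inner_left]

open UniformSpace Completion in
theorem hilbertTensorOp_star (S : V₁ →L[ℂ] V₁) (T : V₂ →L[ℂ] V₂) :
    hilbertTensorOp (star S) (star T) = star (hilbertTensorOp S T) := by
  refine (ContinuousLinearMap.eq_adjoint_iff _ _).2 fun v w => ?_
  induction v, w using induction_on₂ with
  | hp => exact isClosed_eq (by fun_prop) (by fun_prop)
  | ih v w =>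
    rw [hilbertTensorOp_apply_coe, hilbertTensorOp_apply_coe, inner_coe, inner_coe,
      inner_mapL_star]

/-- The tensor product of two ⋆-representations, as a representation of the algebraic tensor
product. -/
noncomputable def tensorRep (π₁ : A →⋆ₙₐ[ℂ] (V₁ →L[ℂ] V₁)) (π₂ : A →⋆ₙₐ[ℂ] (V₂ →L[ℂ] V₂)) :
    A ⊗[ℂ] A →ₙₐ[ℂ] (UniformSpace.Completion (V₁ ⊗[ℂ] V₂) →L[ℂ]
      UniformSpace.Completion (V₁ ⊗[ℂ] V₂)) :=
  let Λ := TensorProduct.lift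
    (hilbertTensorOp.compl₁₂ (π₁ : A →ₗ[ℂ] (V₁ →L[ℂ] V₁)) (π₂ : A →ₗ[ℂ] (V₂ →L[ℂ] V₂)))
  { toFun := Λ
    map_smul' := fun c t => map_smul Λ c t
    map_zero' := map_zero Λ
    map_add' := map_add Λ
    map_mul' := fun s t => by
      induction s with
      | zero => rw [zero_mul, map_zero, zero_mul]
      | add s s' h h' => rw [add_mul, map_add, map_add, h, h', add_mul]
      | tmul a b =>
        induction t with
        | zero => rw [mul_zero, map_zero, mul_zero]
        | add t t' h h' => rw [mul_add, map_add, map_add, h, h', mul_add]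
        | tmul a' b' =>
          rw [Algebra.TensorProduct.tmul_mul_tmul]
          change hilbertTensorOp (π₁ (a * a')) (π₂ (b * b')) =
            hilbertTensorOp (π₁ a) (π₂ b) * hilbertTensorOp (π₁ a') (π₂ b')
          rw [map_mul π₁, map_mul π₂, hilbertTensorOp_mul] }

theorem tensorRep_tmul (π₁ : A →⋆ₙₐ[ℂ] (V₁ →L[ℂ] V₁)) (π₂ : A →⋆ₙₐ[ℂ] (V₂ →L[ℂ] V₂)) (a b : A) :
    tensorRep π₁ π₂ (a ⊗ₜ b) = hilbertTensorOp (π₁ a) (π₂ b) := rfl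

end Representations

/-! ### States of the balanced tensor product -/

section BalancedStates

variable {A : Type u} [NonUnitalCStarAlgebra A] {Z : Type v} {act : Z → A → A}

variable (act) in
/-- The canonical linear map from the algebraic to the balanced tensor product. -/
noncomputable def balancedMk : A ⊗[ℂ] A →ₗ[ℂ] BalancedTensor act where
  toFun t := ⟨universalRep act t, (algebraicBalanced act).le_topologicalClosure ⟨t, rfl⟩⟩
  map_add' s t := Subtype.ext (Subtype.ext (funext fun i => map_add i.π s t))
  map_smul' c t := Subtype.ext (Subtype.ext (funext fun i => map_smul i.π c t))

theorem denseRange_balancedMk : DenseRange (balancedMk act) := by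
  intro x
  have hx : x.1 ∈ closure (algebraicBalanced act : Set (BalancedProd act)) := x.2
  refine closure_subtype.2 (closure_mono ?_ hx)
  rintro _ ⟨t, rfl⟩
  exact ⟨balancedMk act t, ⟨t, rfl⟩, rfl⟩

theorem norm_balancedTmul_le (f g : A) : ‖balancedTmul act f g‖ ≤ ‖f‖ * ‖g‖ :=
  lp.norm_le_of_forall_le (by positivity) fun i => norm_tensor_le i.π i.map_star' f g

theorem star_balancedTmul_mul_self (f g : A) :
    star (balancedTmul act f g) * balancedTmul act f g =
      balancedTmul act (star f * f) (star g * g) :=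
  Subtype.ext (Subtype.ext (funext fun i =>
    (congrArg (· * i.π (f ⊗ₜ g)) (i.map_star' f g).symm).trans
      ((map_mul i.π _ _).symm.trans
        (congrArg i.π (Algebra.TensorProduct.tmul_mul_tmul _ _ _ _)))))

theorem balancedTmul_act (l : Z) (f g : A) :
    balancedTmul act (act l f) g = balancedTmul act f (act l g) :=
  Subtype.ext (Subtype.ext (funext fun i => i.balanced' l f g))

/-- Bounded functionals on the balanced tensor product agree if they agree on simple tensors. -/
theorem BalancedTensor.functional_ext {φ ψ : StrongDual ℂ (BalancedTensor act)}
    (h : ∀ f g, φ (balancedTmul act f g) = ψ (balancedTmul act f g)) : φ = ψ := by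
  have h1 : φ.toLinearMap ∘ₗ balancedMk act = ψ.toLinearMap ∘ₗ balancedMk act :=
    TensorProduct.ext' h
  exact ContinuousLinearMap.coeFn_injective (denseRange_balancedMk.equalizer φ.continuous
    ψ.continuous (funext fun t => LinearMap.congr_fun h1 t))

/-- The vector functional `x ↦ ⟨ξ, x ξ⟩` of a balanced representation. -/
noncomputable def BalancedRep.vectorFunctional (i : BalancedRep act) (ξ : i.V) :
    StrongDual ℂ (BalancedTensor act) :=
  LinearMap.mkContinuous
    { toFun := fun x => ⟪ξ, x.1 i ξ⟫_ℂ
      map_add' := fun x y => inner_add_right ξ (x.1 i ξ) (y.1 i ξ)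
      map_smul' := fun c x => inner_smul_right ξ (x.1 i ξ) c } (‖ξ‖ ^ 2) fun x => by
    have hx : ‖x.1 i‖ ≤ ‖x‖ := lp.norm_apply_le_norm ENNReal.top_ne_zero x.1 i
    calc ‖⟪ξ, x.1 i ξ⟫_ℂ‖ ≤ ‖ξ‖ * ‖x.1 i ξ‖ := norm_inner_le_norm _ _
      _ ≤ ‖ξ‖ * (‖x‖ * ‖ξ‖) := by
          gcongr
          exact (x.1 i).le_of_opNorm_le hx ξ
      _ = ‖ξ‖ ^ 2 * ‖x‖ := by ring

theorem BalancedRep.norm_vectorFunctional_le (i : BalancedRep act) (ξ : i.V) :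
    ‖i.vectorFunctional ξ‖ ≤ ‖ξ‖ ^ 2 :=
  LinearMap.mkContinuous_norm_le _ (by positivity) _

theorem BalancedRep.vectorFunctional_balancedTmul (i : BalancedRep act) (ξ : i.V) (f g : A) :
    i.vectorFunctional ξ (balancedTmul act f g) = ⟪ξ, i.π (f ⊗ₜ g) ξ⟫_ℂ := rfl

theorem BalancedRep.isPositiveFunctional_vectorFunctional (i : BalancedRep act) (ξ : i.V) :
    IsPositiveFunctional (i.vectorFunctional ξ) := fun x => by
  change 0 ≤ ⟪ξ, (star (x.1 i) * x.1 i) ξ⟫_ℂ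
  rw [mul_apply_eq_comp, ContinuousLinearMap.star_eq_adjoint,
    ContinuousLinearMap.adjoint_inner_right, inner_self_eq_norm_sq_to_K, ← RCLike.ofReal_pow]
  exact Complex.zero_le_real.2 (sq_nonneg _)

/-- For fixed g the functional f ↦ φ₁(f) φ₂(g) has norm |φ₂(g)|; since simple tensors satisfy ‖f ⊗
g‖ ≤ ‖f‖‖g‖, this yields |φ₂(g)| ≤ ‖φ‖‖g‖. -/
theorem IsTensorOf.one_le_norm {φ : StrongDual ℂ (BalancedTensor act)} {φ₁ φ₂ : StrongDual ℂ A}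
    (h : IsTensorOf φ φ₁ φ₂) (h₁ : ‖φ₁‖ = 1) (h₂ : ‖φ₂‖ = 1) : 1 ≤ ‖φ‖ := by
  have hb : ∀ f g, ‖φ₁ f‖ * ‖φ₂ g‖ ≤ ‖φ‖ * (‖f‖ * ‖g‖) := fun f g => by
    rw [← norm_mul, ← h f g]
    exact (φ.le_opNorm _).trans
      (mul_le_mul_of_nonneg_left (norm_balancedTmul_le f g) (norm_nonneg _))
  have hg : ∀ g, ‖φ₂ g‖ ≤ ‖φ‖ * ‖g‖ := fun g => by
    have : ‖φ₂ g • φ₁‖ ≤ ‖φ‖ * ‖g‖ :=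
      ContinuousLinearMap.opNorm_le_bound _ (by positivity) fun f => by
        rw [smul_apply, norm_smul, mul_comm]
        exact (hb f g).trans_eq (by ring)
    rwa [norm_smul, h₁, mul_one] at this
  rw [← h₂]
  exact φ₂.opNorm_le_bound (norm_nonneg _) hg

/-- If two states see the action through the same scalars, their tensor product is a state of the
balanced tensor product. -/
theorem exists_mem_stateSpace_isTensorOf (hact : ∀ l f g, act l f * g = act l (f * g))
    {φ₁ φ₂ : StrongDual ℂ A} (h₁ : φ₁ ∈ stateSpace A) (h₂ : φ₂ ∈ stateSpace A) (c : Z → ℂ)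
    (hc₁ : ∀ l f, φ₁ (star (act l f - c l • f) * (act l f - c l • f)) = 0)
    (hc₂ : ∀ l f, φ₂ (star (act l f - c l • f) * (act l f - c l • f)) = 0) :
    ∃ φ ∈ stateSpace (BalancedTensor act), IsTensorOf φ φ₁ φ₂ := by
  obtain ⟨V₁, _, _, _, π₁, ξ₁, hπ₁, hξ₁, hk₁⟩ :=
    (stateSpace.isPositiveFunctional h₁).exists_gns
  obtain ⟨V₂, _, _, _, π₂, ξ₂, hπ₂, hξ₂, hk₂⟩ :=
    (stateSpace.isPositiveFunctional h₂).exists_gns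
  -- The defect act l f − c(l) f, multiplied on the right by b, is the defect of f b, hence again
  -- null for φ₁. So the GNS representation annihilates it.
  have hs₁ : ∀ l f, π₁ (act l f) = c l • π₁ f := fun l f => by
    rw [← map_smul, ← sub_eq_zero, ← map_sub]
    exact hk₁ _ fun b => by rw [sub_mul, hact, smul_mul_assoc, hc₁]
  have hs₂ : ∀ l f, π₂ (act l f) = c l • π₂ f := fun l f => by
    rw [← map_smul, ← sub_eq_zero, ← map_sub]
    exact hk₂ _ fun b => by rw [sub_mul, hact, smul_mul_assoc, hc₂]
  let i : BalancedRep act :=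
    { V := UniformSpace.Completion (V₁ ⊗[ℂ] V₂)
      π := tensorRep π₁ π₂
      map_star' := fun f g => by
        rw [tensorRep_tmul, tensorRep_tmul, StarHomClass.map_star π₁, StarHomClass.map_star π₂,
          hilbertTensorOp_star]
      balanced' := fun l f g => by
        rw [tensorRep_tmul, tensorRep_tmul, hs₁, hs₂, map_smul, map_smul, LinearMap.smul_apply] }
  let ξ : i.V := ((ξ₁ ⊗ₜ[ℂ] ξ₂ : V₁ ⊗[ℂ] V₂) : UniformSpace.Completion (V₁ ⊗[ℂ] V₂))
  have ht : IsTensorOf (i.vectorFunctional ξ) φ₁ φ₂ := fun f g => by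
    rw [i.vectorFunctional_balancedTmul]
    change ⟪((ξ₁ ⊗ₜ[ℂ] ξ₂ : V₁ ⊗[ℂ] V₂) : UniformSpace.Completion (V₁ ⊗[ℂ] V₂)),
      hilbertTensorOp (π₁ f) (π₂ g) ((ξ₁ ⊗ₜ[ℂ] ξ₂ : V₁ ⊗[ℂ] V₂) :
        UniformSpace.Completion (V₁ ⊗[ℂ] V₂))⟫_ℂ = _
    rw [hilbertTensorOp_apply_coe, UniformSpace.Completion.inner_coe, TensorProduct.mapL_tmul,
      TensorProduct.inner_tmul, hπ₁, hπ₂]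
  -- The norm is at most ‖ξ₁‖²‖ξ₂‖² ≤ 1 by the GNS bound, and at least 1 by testing on simple
  -- tensors.
  refine ⟨i.vectorFunctional ξ, ⟨i.isPositiveFunctional_vectorFunctional ξ,
    le_antisymm ((i.norm_vectorFunctional_le ξ).trans ?_) (ht.one_le_norm h₁.2 h₂.2)⟩, ht⟩
  have hξ : ‖ξ‖ = ‖ξ₁‖ * ‖ξ₂‖ :=
    (UniformSpace.Completion.norm_coe _).trans (TensorProduct.norm_tmul _ _)
  rw [hξ, mul_pow]
  rw [h₁.2] at hξ₁
  rw [h₂.2] at hξ₂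
  exact mul_le_one₀ hξ₁ (by positivity) hξ₂

end BalancedStates

/-! ### Purity of tensor products of pure states -/

section PureTensors

variable {A : Type u} [NonUnitalCStarAlgebra A]

/-- Linear maps on a C⋆-algebra agree if they agree on positive elements. -/
theorem LinearMap.ext_star_mul_self {M : Type*} [AddCommMonoid M] [Module ℂ M] {F G : A →ₗ[ℂ] M}
    (h : ∀ a, F (star a * a) = G (star a * a)) : F = G := by
  let _ := CStarAlgebra.spectralOrder A
  have _ := CStarAlgebra.spectralOrderedRing A
  refine LinearMap.ext_on (CStarAlgebra.span_nonneg (A := A)) fun a ha => ?_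
  obtain ⟨d, rfl⟩ := CStarAlgebra.nonneg_iff_eq_star_mul_self.1 (show (0 : A) ≤ a from ha)
  exact h d

theorem stateSpace.exists_re_apply_star_mul_self_pos {φ : StrongDual ℂ A}
    (hφ : φ ∈ stateSpace A) : ∃ a, 0 < (φ (star a * a)).re := by
  obtain ⟨a, ha⟩ := stateSpace.exists_apply_ne_zero hφ
  refine ⟨a, ?_⟩
  have h := (stateSpace.isPositiveFunctional hφ).norm_sq_apply_le a
  rw [hφ.2, one_mul] at h
  exact (pow_pos (norm_pos_iff.2 ha) 2).trans_le h

/-- The states in a decomposition of `φ` are dominated by multiples of `φ`. -/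
theorem exists_re_apply_le_of_mem_openSegment {φ ψ χ : StrongDual ℂ A}
    (hχ : χ ∈ stateSpace A) (h : φ ∈ openSegment ℝ ψ χ) :
    ∃ c : ℝ, 0 ≤ c ∧ ∀ a, (ψ (star a * a)).re ≤ c * (φ (star a * a)).re := by
  obtain ⟨t, s, ht, hs, -, rfl⟩ := h
  refine ⟨t⁻¹, inv_nonneg.2 ht.le, fun a => ?_⟩
  rw [le_inv_mul_iff₀ ht, add_apply, smul_apply, smul_apply, Complex.add_re, Complex.smul_re,
    Complex.smul_re, smul_eq_mul, smul_eq_mul]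
  have := mul_nonneg hs.le ((stateSpace.isPositiveFunctional hχ).re_nonneg a)
  linarith

theorem eq_of_eq_smul_of_mem_stateSpace {φ ψ : StrongDual ℂ A} (hφ : φ ∈ stateSpace A)
    (hψ : ψ ∈ stateSpace A) {r : ℝ} (hr : 0 ≤ r) (h : ψ = r • φ) : ψ = φ := by
  have h1 : ‖ψ‖ = r * ‖φ‖ := by rw [h, norm_smul, Real.norm_of_nonneg hr]
  rw [hφ.2, hψ.2, mul_one] at h1
  rw [h, ← h1, one_smul]

variable {Z : Type v} {act : Z → A → A}

/-- The functional `f ↦ ψ (f ⊗ g)`. -/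
noncomputable def leftSlice (ψ : StrongDual ℂ (BalancedTensor act)) (g : A) : StrongDual ℂ A :=
  (ψ.toLinearMap ∘ₗ balancedMk act ∘ₗ (TensorProduct.mk ℂ A A).flip g).mkContinuous (‖ψ‖ * ‖g‖)
    fun f => (ψ.le_opNorm _).trans ((mul_le_mul_of_nonneg_left (norm_balancedTmul_le f g)
      (norm_nonneg _)).trans_eq (by ring))

/-- The functional `g ↦ ψ (f ⊗ g)`. -/
noncomputable def rightSlice (ψ : StrongDual ℂ (BalancedTensor act)) (f : A) : StrongDual ℂ A :=
  (ψ.toLinearMap ∘ₗ balancedMk act ∘ₗ TensorProduct.mk ℂ A A f).mkContinuous (‖ψ‖ * ‖f‖)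
    fun g => (ψ.le_opNorm _).trans ((mul_le_mul_of_nonneg_left (norm_balancedTmul_le f g)
      (norm_nonneg _)).trans_eq (by ring))

theorem leftSlice_apply (ψ : StrongDual ℂ (BalancedTensor act)) (f g : A) :
    leftSlice ψ g f = ψ (balancedTmul act f g) := rfl

/-- A state of the balanced tensor product which is the tensor product of two pure states is
pure. -/
theorem IsTensorOf.mem_pureStates {φ : StrongDual ℂ (BalancedTensor act)} {φ₁ φ₂ : StrongDual ℂ A}
    (h : IsTensorOf φ φ₁ φ₂) (hφ : φ ∈ stateSpace (BalancedTensor act))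
    (h₁ : φ₁ ∈ pureStates A) (h₂ : φ₂ ∈ pureStates A) : φ ∈ pureStates (BalancedTensor act) := by
  refine ⟨hφ, fun ψ hψ χ hχ hseg => ?_⟩
  obtain ⟨c, hc, hle⟩ := exists_re_apply_le_of_mem_openSegment hχ hseg
  have hp₁ := stateSpace.isPositiveFunctional h₁.1
  have hp₂ := stateSpace.isPositiveFunctional h₂.1
  have hle' : ∀ f g, (ψ (balancedTmul act (star f * f) (star g * g))).re ≤
      c * ((φ₁ (star f * f)).re * (φ₂ (star g * g)).re) := fun f g => by
    have := hle (balancedTmul act f g)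
    rwa [star_balancedTmul_mul_self, h, ← hp₁.ofReal_re, ← hp₂.ofReal_re,
      ← Complex.ofReal_mul, Complex.ofReal_re] at this
  have hpos : ∀ f g, 0 ≤ ψ (balancedTmul act (star f * f) (star g * g)) := fun f g => by
    rw [← star_balancedTmul_mul_self]
    exact hψ.1 _
  -- Slicing ψ at a positive element gives a positive functional dominated by a multiple of a pure
  -- state, so each slice is a multiple of φ₁ or of φ₂.
  have hleft : ∀ g, ∃ r : ℝ, 0 ≤ r ∧ leftSlice ψ (star g * g) = r • φ₁ := fun g =>
    pureStates.exists_eq_smul_of_le h₁ (fun f => hpos f g)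
      (c := c * (φ₂ (star g * g)).re) fun f => (hle' f g).trans_eq (by ring)
  obtain ⟨a, ha⟩ := stateSpace.exists_re_apply_star_mul_self_pos h₁.1
  obtain ⟨r, hr, hright⟩ : ∃ r : ℝ, 0 ≤ r ∧ rightSlice ψ (star a * a) = r • φ₂ :=
    pureStates.exists_eq_smul_of_le h₂ (fun g => hpos a g)
      (c := c * (φ₁ (star a * a)).re) fun g => (hle' a g).trans_eq (by ring)
  refine eq_of_eq_smul_of_mem_stateSpace hφ hψ (r := r / (φ₁ (star a * a)).re)
    (div_nonneg hr ha.le) (BalancedTensor.functional_ext fun f g => ?_)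
  -- Evaluating ψ at (a*a) ⊗ (g*g) through both slices gives s φ₁(a*a) = r φ₂(g*g). This determines
  -- s, and positive elements span, so positive g suffice.
  have key : (rightSlice ψ f).toLinearMap =
      (((r / (φ₁ (star a * a)).re : ℝ) : ℂ) * φ₁ f) • φ₂.toLinearMap := by
    refine LinearMap.ext_star_mul_self fun g => ?_
    obtain ⟨s, -, hs⟩ := hleft g
    have e1 : ψ (balancedTmul act f (star g * g)) = s * φ₁ f := by
      rw [← leftSlice_apply, hs, smul_apply, Complex.real_smul]
    have e2 : (s : ℂ) * φ₁ (star a * a) = r * φ₂ (star g * g) := by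
      rw [← Complex.real_smul, ← Complex.real_smul, ← smul_apply, ← smul_apply, ← hs, ← hright]
      rfl
    have hne : φ₁ (star a * a) ≠ 0 := fun h0 => by
      rw [h0, Complex.zero_re] at ha
      exact ha.false
    change ψ (balancedTmul act f (star g * g)) =
      (((r / (φ₁ (star a * a)).re : ℝ) : ℂ) * φ₁ f) * φ₂ (star g * g)
    rw [e1, Complex.ofReal_div, hp₁.ofReal_re, eq_div_of_mul_eq hne e2]
    ring
  rw [smul_apply, h, Complex.real_smul, ← mul_assoc]
  exact LinearMap.congr_fun key g

end PureTensors

/-! ### The central action of `C₀(X)` -/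

section FieldOperations

variable {X : Type u} [TopologicalSpace X]
variable {H : Type v} [NormedAddCommGroup H] [InnerProductSpace ℂ H] [CompleteSpace H]

theorem centralMul_apply (l : C₀(X, ℂ)) (f : CompactField X H) (x : X) :
    centralMul l f x = l x • f x := rfl

theorem CompactField.norm_le {f : CompactField X H} {C : ℝ} (hC : 0 ≤ C)
    (h : ∀ x, ‖f x‖ ≤ C) : ‖f‖ ≤ C := by
  rw [← ZeroAtInftyContinuousMap.norm_toBCF_eq_norm]
  exact (BoundedContinuousFunction.norm_le hC).2 h

theorem CompactField.norm_apply_le (f : CompactField X H) (x : X) : ‖f x‖ ≤ ‖f‖ :=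
  f.toBCF.norm_coe_le_norm x

theorem ZeroAtInftyContinuousMap.norm_apply_le_norm (l : C₀(X, ℂ)) (x : X) : ‖l x‖ ≤ ‖l‖ :=
  l.toBCF.norm_coe_le_norm x

theorem norm_centralMul_le (l : C₀(X, ℂ)) (f : CompactField X H) :
    ‖centralMul l f‖ ≤ ‖l‖ * ‖f‖ :=
  CompactField.norm_le (by positivity) fun x => by
    rw [centralMul_apply, norm_smul]
    exact mul_le_mul (l.norm_apply_le_norm x) (f.norm_apply_le x) (norm_nonneg _) (norm_nonneg _)

variable (X H) in
/-- The central action, as a bilinear map. -/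
noncomputable def centralMulₗ : C₀(X, ℂ) →ₗ[ℂ] CompactField X H →ₗ[ℂ] CompactField X H :=
  LinearMap.mk₂ ℂ centralMul
    (fun l m f => ZeroAtInftyContinuousMap.ext fun x => add_smul (l x) (m x) (f x))
    (fun c l f => ZeroAtInftyContinuousMap.ext fun x => smul_assoc c (l x) (f x))
    (fun l f g => ZeroAtInftyContinuousMap.ext fun x => smul_add (l x) (f x) (g x))
    (fun c l f => ZeroAtInftyContinuousMap.ext fun x => smul_comm (l x) c (f x))

theorem centralMul_mul (l m : C₀(X, ℂ)) (f : CompactField X H) :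
    centralMul (l * m) f = centralMul l (centralMul m f) :=
  ZeroAtInftyContinuousMap.ext fun x => mul_smul (l x) (m x) (f x)

theorem centralMul_mul_assoc (l : C₀(X, ℂ)) (f g : CompactField X H) :
    centralMul l f * g = centralMul l (f * g) :=
  ZeroAtInftyContinuousMap.ext fun x => smul_mul_assoc (l x) (f x) (g x)

theorem star_centralMul_mul_self (l : C₀(X, ℂ)) (f : CompactField X H) :
    star (centralMul l f) * centralMul l f = centralMul (star l * l) (star f * f) :=
  ZeroAtInftyContinuousMap.ext fun x => by
    change star (l x • f x) * (l x • f x) = (star (l x) * l x) • (star (f x) * f x)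
    rw [star_smul, smul_mul_smul_comm]

theorem fiberState_apply (S : X) (ω : StrongDual ℂ (CompactOp H)) (f : CompactField X H) :
    fiberState S ω f = ω (f S) := rfl

theorem fiberState_centralMul (S : X) (ω : StrongDual ℂ (CompactOp H)) (l : C₀(X, ℂ))
    (f : CompactField X H) : fiberState S ω (centralMul l f) = l S * fiberState S ω f :=
  map_smul ω (l S) (f S)

/-- Multiplication by a bounded continuous function. -/
theorem exists_bounded_smul (s : X → ℂ) (hs : Continuous s) {C : ℝ} (hC : ∀ x, ‖s x‖ ≤ C)
    (f : CompactField X H) : ∃ g : CompactField X H, ∀ x, g x = s x • f x := by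
  refine ⟨⟨⟨fun x => s x • f x, hs.smul (map_continuous f)⟩, ?_⟩, fun x => rfl⟩
  refine squeeze_zero_norm (a := fun x => C * ‖f x‖) (fun x => ?_) ?_
  · rw [norm_smul]
    exact mul_le_mul_of_nonneg_right (hC x) (norm_nonneg _)
  · simpa using ((zero_at_infty f).norm).const_mul C

/-- Take d = √(‖m‖² − |m|²) f. For a positive functional φ this makes f ↦ φ(|m|² f) dominated by
‖m‖² φ, as the Schur-type principle requires. The square root is bounded but need not vanish at
infinity. -/
theorem exists_star_mul_self_eq_sub_centralMul (m : C₀(X, ℂ)) (f : CompactField X H) :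
    ∃ d : CompactField X H, star d * d =
      ((‖m‖ ^ 2 : ℝ) : ℂ) • (star f * f) - centralMul (star m * m) (star f * f) := by
  have hnn : ∀ x, 0 ≤ ‖m‖ ^ 2 - ‖m x‖ ^ 2 := fun x =>
    sub_nonneg.2 (pow_le_pow_left₀ (norm_nonneg _) (m.norm_apply_le_norm x) 2)
  obtain ⟨d, hd⟩ := exists_bounded_smul (fun x => ((√(‖m‖ ^ 2 - ‖m x‖ ^ 2) : ℝ) : ℂ))
    (Complex.continuous_ofReal.comp (Real.continuous_sqrt.comp
      (continuous_const.sub ((map_continuous m).norm.pow 2)))) (C := ‖m‖)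
    (fun x => by
      rw [Complex.norm_real, Real.norm_of_nonneg (Real.sqrt_nonneg _)]
      refine Real.sqrt_le_iff.2 ⟨norm_nonneg _, ?_⟩
      linarith [sq_nonneg ‖m x‖]) f
  refine ⟨d, ZeroAtInftyContinuousMap.ext fun x => ?_⟩
  change star (d x) * d x = ((‖m‖ ^ 2 : ℝ) : ℂ) • (star (f x) * f x) -
    (star (m x) * m x) • (star (f x) * f x)
  rw [hd, star_smul, smul_mul_smul_comm, ← sub_smul]
  congr 1
  have h1 : star (m x) * m x = ((‖m x‖ ^ 2 : ℝ) : ℂ) := by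
    rw [Complex.ofReal_pow]
    exact Complex.conj_mul' (m x)
  rw [h1, ← Complex.ofReal_sub, Complex.star_def, Complex.conj_ofReal, ← Complex.ofReal_mul,
    Real.mul_self_sqrt (hnn x)]

end FieldOperations

/-! ### Cut-off functions and characters of `C₀(X)` -/

section Urysohn

variable {X : Type u} [TopologicalSpace X] [LocallyCompactSpace X] [T2Space X]
variable {H : Type v} [NormedAddCommGroup H] [InnerProductSpace ℂ H] [CompleteSpace H]

theorem exists_zeroAtInfty_one_zero {K U : Set X} (hK : IsCompact K) (hU : IsOpen U)
    (hKU : K ⊆ U) : ∃ l : C₀(X, ℂ), (∀ x ∈ K, l x = 1) ∧ (∀ x ∉ U, l x = 0) ∧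
      ∀ x, ‖l x‖ ≤ 1 ∧ ‖1 - l x‖ ≤ 1 := by
  obtain ⟨r, h1, h0, hc, hr⟩ := exists_continuous_one_zero_of_isCompact hK hU.isClosed_compl
    (Set.disjoint_compl_right_iff_subset.2 hKU)
  have hc' : HasCompactSupport fun x => (r x : ℂ) := hc.comp_left Complex.ofReal_zero
  refine ⟨⟨⟨fun x => (r x : ℂ), Complex.continuous_ofReal.comp r.continuous⟩,
    hc'.is_zero_at_infty⟩, fun x hx => ?_, fun x hx => ?_, fun x => ⟨?_, ?_⟩⟩
  · change (r x : ℂ) = 1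
    rw [h1 hx]; simp
  · change (r x : ℂ) = 0
    rw [h0 hx]; simp
  · change ‖(r x : ℂ)‖ ≤ 1
    rw [Complex.norm_real, Real.norm_of_nonneg (hr x).1]
    exact (hr x).2
  · change ‖1 - (r x : ℂ)‖ ≤ 1
    rw [← Complex.ofReal_one, ← Complex.ofReal_sub, Complex.norm_real,
      Real.norm_of_nonneg (sub_nonneg.2 (hr x).2)]
    linarith [(hr x).1]

theorem exists_zeroAtInfty_apply_eq_one (S : X) :
    ∃ l : C₀(X, ℂ), l S = 1 ∧ ∀ x, ‖l x‖ ≤ 1 := by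
  obtain ⟨l, h1, -, h⟩ := exists_zeroAtInfty_one_zero isCompact_singleton isOpen_univ
    (Set.subset_univ {S})
  exact ⟨l, h1 S rfl, fun x => (h x).1⟩

theorem exists_zeroAtInfty_separating {S T : X} (hST : S ≠ T) :
    ∃ l : C₀(X, ℂ), l S = 1 ∧ l T = 0 := by
  obtain ⟨l, h1, h0, -⟩ := exists_zeroAtInfty_one_zero isCompact_singleton
    (isOpen_compl_singleton (x := T)) (Set.singleton_subset_iff.2 hST)
  exact ⟨l, h1 S rfl, h0 T fun h => h rfl⟩

theorem ZeroAtInftyContinuousMap.isCompact_setOf_le_norm {X E : Type*} [TopologicalSpace X]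
    [NormedAddCommGroup E] (f : C₀(X, E)) {ε : ℝ} (hε : 0 < ε) : IsCompact {x | ε ≤ ‖f x‖} := by
  have h : ∀ᶠ x in Filter.cocompact X, ‖f x‖ < ε :=
    (by simpa using (zero_at_infty f).norm : Filter.Tendsto (fun x => ‖f x‖) _ (nhds 0)).eventually
      (gt_mem_nhds hε)
  obtain ⟨K, hK, hKs⟩ := Filter.mem_cocompact.1 h
  refine hK.of_isClosed_subset (isClosed_le continuous_const (map_continuous f).norm) fun x hx => ?_
  by_contra hxK
  exact absurd (show ‖f x‖ < ε from hKs hxK) (not_lt.2 hx)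

/-- The set where ‖f‖ ≥ ε is compact; a cut-off equal to 1 there changes f only where it is already
small. Thus the central action is nondegenerate. -/
theorem exists_norm_sub_centralMul_le (f : CompactField X H) {ε : ℝ} (hε : 0 < ε) :
    ∃ l : C₀(X, ℂ), ‖f - centralMul l f‖ ≤ ε := by
  obtain ⟨l, h1, -, hl⟩ := exists_zeroAtInfty_one_zero (f.isCompact_setOf_le_norm hε) isOpen_univ
    (Set.subset_univ _)
  refine ⟨l, CompactField.norm_le hε.le fun x => ?_⟩
  have e : (f - centralMul l f) x = (1 - l x) • f x := by
    rw [sub_smul, one_smul]; rfl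
  rw [e, norm_smul]
  by_cases hx : ε ≤ ‖f x‖
  · rw [h1 x hx, sub_self, norm_zero, zero_mul]
    exact hε.le
  · exact (mul_le_of_le_one_left (norm_nonneg _) (hl x).2).trans (not_le.1 hx).le

/-- The cut-off is supported in the neighbourhood of S where ‖f‖ < ε. -/
theorem exists_norm_centralMul_le (f : CompactField X H) {S : X} (hS : f S = 0) {ε : ℝ}
    (hε : 0 < ε) : ∃ l : C₀(X, ℂ), l S = 1 ∧ ‖centralMul l f‖ ≤ ε := by
  obtain ⟨l, h1, h0, hl⟩ := exists_zeroAtInfty_one_zero isCompact_singleton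
    (isOpen_lt (map_continuous f).norm continuous_const : IsOpen {x | ‖f x‖ < ε})
    (Set.singleton_subset_iff.2 (show ‖f S‖ < ε by rwa [hS, norm_zero]))
  refine ⟨l, h1 S rfl, CompactField.norm_le hε.le fun x => ?_⟩
  rw [centralMul_apply, norm_smul]
  by_cases hx : ‖f x‖ < ε
  · exact (mul_le_of_le_one_left (norm_nonneg _) (hl x).1).trans hx.le
  · rw [h0 x hx, norm_zero, zero_mul]
    exact hε.le

/-- Non-zero characters of `C₀(X)` are point evaluations. -/
theorem exists_eq_eval_of_multiplicative (χ : C₀(X, ℂ) →ₗ[ℂ] ℂ)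
    (hmul : ∀ l m, χ (l * m) = χ l * χ m) (hne : χ ≠ 0) : ∃ S, ∀ l, χ l = l S := by
  obtain ⟨k, hk⟩ : ∃ k, χ k = 1 := by
    obtain ⟨k, hk⟩ : ∃ k, χ k ≠ 0 := by
      by_contra! h
      exact hne (LinearMap.ext h)
    exact ⟨(χ k)⁻¹ • k, by rw [map_smul, smul_eq_mul, inv_mul_cancel₀ hk]⟩
  -- The kernel of χ has a common zero. Otherwise finitely many of its elements have no common zero
  -- on the compact set {k = 1}, and p = ∑ |l S|² lies in the kernel and is positive there.
  obtain ⟨S, hS⟩ : ∃ S, ∀ l, χ l = 0 → l S = 0 := by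
    by_contra! h
    choose l hl0 hlne using h
    have hK : IsCompact {x | k x = 1} :=
      (k.isCompact_setOf_le_norm (ε := 1) one_pos).of_isClosed_subset
        (isClosed_eq (map_continuous k) continuous_const) fun x (hx : k x = 1) =>
          (by rw [hx, norm_one] : ‖k x‖ = 1).ge
    obtain ⟨t, ht⟩ := hK.elim_finite_subcover (fun S => {x | l S x ≠ 0})
      (fun S => isOpen_ne_fun (map_continuous (l S)) continuous_const)
      fun x _ => Set.mem_iUnion.2 ⟨x, hlne x⟩
    set p : C₀(X, ℂ) := ∑ S ∈ t, star (l S) * l S with hp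
    have hχp : χ p = 0 := by
      rw [hp, map_sum]
      exact Finset.sum_eq_zero fun S _ => by rw [hmul, hl0, mul_zero]
    -- Formally 1 + q = |1 − k|² + p, which is positive everywhere: p handles {k = 1} and the square
    -- the rest.
    set q : C₀(X, ℂ) := star k * k - k - star k + p with hq
    have hpx : ∀ x, p x = ((∑ S ∈ t, ‖l S x‖ ^ 2 : ℝ) : ℂ) := fun x => by
      have hev : ∀ s : Finset X, (∑ S ∈ s, star (l S) * l S : C₀(X, ℂ)) x =
          ((∑ S ∈ s, ‖l S x‖ ^ 2 : ℝ) : ℂ) := fun s => by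
        classical
        induction s using Finset.induction_on with
        | empty => simp
        | insert a s ha ih =>
          rw [Finset.sum_insert ha, Finset.sum_insert ha, ZeroAtInftyContinuousMap.add_apply, ih,
            Complex.ofReal_add, Complex.ofReal_pow]
          congr 1
          exact Complex.conj_mul' (l a x)
      exact hev t
    have hqx : ∀ x, 1 + q x = ((‖1 - k x‖ ^ 2 + ∑ S ∈ t, ‖l S x‖ ^ 2 : ℝ) : ℂ) := fun x => by
      rw [Complex.ofReal_add, ← hpx, Complex.ofReal_pow, ← Complex.conj_mul', map_sub, map_one]
      change 1 + (star (k x) * k x - k x - star (k x) + p x) = _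
      rw [Complex.star_def]
      ring
    have hqne : ∀ x, 1 + q x ≠ 0 := fun x => by
      rw [hqx, Complex.ofReal_ne_zero]
      refine ne_of_gt ?_
      by_cases hx : k x = 1
      · obtain ⟨S, hS, hSx⟩ := Set.mem_iUnion₂.1 (ht hx)
        have h1 : 0 < ‖l S x‖ ^ 2 := pow_pos (norm_pos_iff.2 hSx) 2
        have h2 : ‖l S x‖ ^ 2 ≤ ∑ S ∈ t, ‖l S x‖ ^ 2 :=
          Finset.single_le_sum (f := fun S => ‖l S x‖ ^ 2) (fun _ _ => sq_nonneg _) hS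
        exact add_pos_of_nonneg_of_pos (sq_nonneg _) (h1.trans_le h2)
      · have h1 : 0 < ‖1 - k x‖ := norm_pos_iff.2 (sub_ne_zero.2 (Ne.symm hx))
        have h2 : 0 ≤ ∑ S ∈ t, ‖l S x‖ ^ 2 := Finset.sum_nonneg fun _ _ => sq_nonneg _
        exact add_pos_of_pos_of_nonneg (pow_pos h1 2) h2
    -- This r is a quasi-inverse of q in `C₀(X)`. Since χ(k) = 1 and χ(p) = 0 force χ(q) = −1,
    -- applying χ to q = r + q r gives −1 = 0; neither continuity nor ⋆-invariance of χ enters.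
    let r : C₀(X, ℂ) := ⟨⟨fun x => q x / (1 + q x), (map_continuous q).div
      (continuous_const.add (map_continuous q)) hqne⟩, by
        have h1 : Filter.Tendsto (fun x => q x / (1 + q x)) (Filter.cocompact X)
            (nhds (0 / (1 + 0))) :=
          (zero_at_infty q).div ((zero_at_infty q).const_add 1) (by simp)
        rwa [zero_div] at h1⟩
    have hr : q = r + q * r := ZeroAtInftyContinuousMap.ext fun x => by
      change q x = q x / (1 + q x) + q x * (q x / (1 + q x))
      field_simp [hqne x]
    have hχq : χ q = -1 := by
      rw [hq, map_add, map_sub, map_sub, hmul, hk, hχp]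
      ring
    have h1 : χ q = χ r + χ q * χ r := by
      rw [← hmul, ← map_add]
      exact congrArg χ hr
    rw [hχq] at h1
    have h0 : (-1 : ℂ) = 0 := h1.trans (by ring)
    norm_num at h0
  have hkS : k S = 1 := by
    obtain ⟨m, hm, -⟩ := exists_zeroAtInfty_apply_eq_one S
    have h1 : (m - k * m) S = 0 := hS _ (by rw [map_sub, hmul, hk, one_mul, sub_self])
    have h2 : m S - k S * m S = 0 := h1
    rw [hm, mul_one] at h2
    exact (sub_eq_zero.1 h2).symm
  refine ⟨S, fun l => ?_⟩
  have h1 : (l - χ l • k) S = 0 :=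
    hS _ (by rw [map_sub, map_smul, hk, smul_eq_mul, mul_one, sub_self])
  have h2 : l S - χ l * k S = 0 := h1
  rw [hkS, mul_one] at h2
  exact (sub_eq_zero.1 h2).symm

end Urysohn

/-! ### Pure states of `C₀(X, 𝒦(H))` -/

section FieldStates

variable {X : Type u} [TopologicalSpace X]
variable {H : Type v} [NormedAddCommGroup H] [InnerProductSpace ℂ H] [CompleteSpace H]

/-- The functional `f ↦ φ (l f)`. -/
noncomputable def centralTranslate (φ : StrongDual ℂ (CompactField X H)) (l : C₀(X, ℂ)) :
    StrongDual ℂ (CompactField X H) :=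
  (φ.toLinearMap ∘ₗ centralMulₗ X H l).mkContinuous (‖φ‖ * ‖l‖) fun f =>
    (φ.le_opNorm _).trans ((mul_le_mul_of_nonneg_left (norm_centralMul_le l f)
      (norm_nonneg _)).trans_eq (by ring))

theorem centralTranslate_apply (φ : StrongDual ℂ (CompactField X H)) (l : C₀(X, ℂ))
    (f : CompactField X H) : centralTranslate φ l f = φ (centralMul l f) := rfl

variable [LocallyCompactSpace X] [T2Space X]

/-- A functional on which `C₀(X)` acts by scalars is concentrated at a point. -/
theorem exists_point_of_centralMul {φ : StrongDual ℂ (CompactField X H)} (hφ : φ ≠ 0)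
    (c : C₀(X, ℂ) → ℂ) (hc : ∀ l f, φ (centralMul l f) = c l * φ f) :
    ∃ S : X, ∀ l, c l = l S := by
  obtain ⟨f₀, hf₀⟩ : ∃ f, φ f ≠ 0 := by
    by_contra! h
    exact hφ (ContinuousLinearMap.ext h)
  let χ : C₀(X, ℂ) →ₗ[ℂ] ℂ := (φ f₀)⁻¹ • (φ.toLinearMap ∘ₗ (centralMulₗ X H).flip f₀)
  have hχ : ∀ l, χ l = c l := fun l => by
    change (φ f₀)⁻¹ * φ (centralMul l f₀) = c l
    rw [hc, mul_comm, mul_assoc, mul_inv_cancel₀ hf₀, mul_one]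
  have hmul : ∀ l m, χ (l * m) = χ l * χ m := fun l m => by
    rw [hχ, hχ, hχ]
    refine mul_right_cancel₀ hf₀ ?_
    rw [← hc, centralMul_mul, hc, hc, mul_assoc]
  -- If χ vanished, φ would kill every l f₀, hence also f₀, which these approximate; the tolerance
  -- forces |φ(f₀)| below its own half.
  have hne : χ ≠ 0 := fun h0 => by
    have hz : ∀ l, φ (centralMul l f₀) = 0 := fun l => by
      rw [hc, ← hχ, h0, LinearMap.zero_apply, zero_mul]
    have hpos : 0 < ‖φ f₀‖ / (2 * (‖φ‖ + 1)) :=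
      div_pos (norm_pos_iff.2 hf₀) (by positivity)
    obtain ⟨l, hl⟩ := exists_norm_sub_centralMul_le f₀ hpos
    have h1 := (φ.le_opNorm (f₀ - centralMul l f₀)).trans
      (mul_le_mul_of_nonneg_left hl (norm_nonneg _))
    rw [map_sub, hz, sub_zero, ← mul_div_assoc, le_div_iff₀ (by positivity)] at h1
    nlinarith [norm_pos_iff.2 hf₀, norm_nonneg φ, mul_nonneg (norm_nonneg φ) (norm_nonneg (φ f₀))]
  obtain ⟨S, hS⟩ := exists_eq_eval_of_multiplicative χ hmul hne
  exact ⟨S, fun l => by rw [← hχ, hS]⟩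

/-- A bump function of norm at most one times the constant k. Lifting without increase of norm
transfers norms and positivity between fibre and field. -/
theorem exists_apply_eq_and_norm_le (S : X) (k : CompactOp H) :
    ∃ f : CompactField X H, f S = k ∧ ‖f‖ ≤ ‖k‖ := by
  obtain ⟨m, hm, hm1⟩ := exists_zeroAtInfty_apply_eq_one S
  refine ⟨⟨⟨fun x => m x • k, (map_continuous m).smul continuous_const⟩, ?_⟩, ?_,
    CompactField.norm_le (norm_nonneg _) fun x => ?_⟩
  · simpa using (zero_at_infty m).smul_const k
  · change m S • k = k
    rw [hm, one_smul]
  · change ‖m x • k‖ ≤ ‖k‖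
    rw [norm_smul]
    exact mul_le_of_le_one_left (norm_nonneg _) (hm1 x)

/-- A functional on which `C₀(X)` acts by evaluation at `S` factors through the fibre at `S`. -/
theorem exists_eq_fiberState {φ : StrongDual ℂ (CompactField X H)} {S : X}
    (hφ : ∀ l f, φ (centralMul l f) = l S * φ f) : ∃ ω, φ = fiberState S ω := by
  -- A cut-off with l(S) = 1 does not change φ(f), yet makes l f arbitrarily small.
  have hz : ∀ f : CompactField X H, f S = 0 → φ f = 0 := fun f hf => by
    have hle : ∀ ε > 0, ‖φ f‖ ≤ ‖φ‖ * ε := fun ε hε => by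
      obtain ⟨l, hl1, hl⟩ := exists_norm_centralMul_le f hf hε
      have h1 := hφ l f
      rw [hl1, one_mul] at h1
      rw [← h1]
      exact (φ.le_opNorm _).trans (mul_le_mul_of_nonneg_left hl (norm_nonneg _))
    rw [← norm_le_zero_iff]
    refine le_of_forall_pos_le_add fun ε hε => ?_
    refine (hle (ε / (‖φ‖ + 1)) (by positivity)).trans ?_
    rw [zero_add, ← mul_div_assoc, div_le_iff₀ (by positivity)]
    nlinarith [norm_nonneg φ]
  have heq : ∀ f g : CompactField X H, f S = g S → φ f = φ g := fun f g h => by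
    rw [← sub_eq_zero, ← map_sub]
    exact hz _ (sub_eq_zero.2 h)
  choose e he hen using exists_apply_eq_and_norm_le (H := H) S
  let ω : CompactOp H →ₗ[ℂ] ℂ :=
    { toFun := fun k => φ (e k)
      map_add' := fun k k' => by
        rw [← map_add]
        exact heq _ _ ((he _).trans (congrArg₂ (· + ·) (he k).symm (he k').symm))
      map_smul' := fun c k => by
        rw [RingHom.id_apply, ← map_smul]
        exact heq _ _ ((he _).trans (congrArg (c • ·) (he k).symm)) }
  refine ⟨ω.mkContinuous ‖φ‖ fun k => (φ.le_opNorm _).trans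
    (mul_le_mul_of_nonneg_left (hen k) (norm_nonneg _)), ContinuousLinearMap.ext fun f => ?_⟩
  exact heq _ _ (he _).symm

theorem norm_fiberState (S : X) (ω : StrongDual ℂ (CompactOp H)) : ‖fiberState S ω‖ = ‖ω‖ := by
  refine le_antisymm ((fiberState S ω).opNorm_le_bound (norm_nonneg ω) fun f => ?_)
    (ω.opNorm_le_bound (norm_nonneg (fiberState S ω)) fun k => ?_)
  · exact (ω.le_opNorm _).trans (mul_le_mul_of_nonneg_left (f.norm_apply_le S) (norm_nonneg _))
  · obtain ⟨f, rfl, hf⟩ := exists_apply_eq_and_norm_le S k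
    exact ((fiberState S ω).le_opNorm f).trans (mul_le_mul_of_nonneg_left hf (norm_nonneg _))

theorem fiberState_mem_stateSpace_iff {S : X} {ω : StrongDual ℂ (CompactOp H)} :
    fiberState S ω ∈ stateSpace (CompactField X H) ↔ ω ∈ stateSpace (CompactOp H) := by
  refine and_congr ⟨fun h k => ?_, fun h f => h (f S)⟩ (by rw [norm_fiberState])
  obtain ⟨f, rfl, -⟩ := exists_apply_eq_and_norm_le S k
  exact h f

theorem fiberState_injective (S : X) :
    Function.Injective (fiberState S : StrongDual ℂ (CompactOp H) → _) := fun ω ω' h => by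
  ext k
  obtain ⟨f, rfl, -⟩ := exists_apply_eq_and_norm_le S k
  exact DFunLike.congr_fun h f

/-- A positive functional dominated by one over `S` lies over `S`. -/
theorem exists_eq_fiberState_of_le {S : X} {ω : StrongDual ℂ (CompactOp H)}
    {ψ : StrongDual ℂ (CompactField X H)} (hψ : IsPositiveFunctional ψ) {c : ℝ}
    (h : ∀ f, (ψ (star f * f)).re ≤ c * (fiberState S ω (star f * f)).re) :
    ∃ ω', ψ = fiberState S ω' := by
  refine exists_eq_fiberState fun l f => ?_
  -- This element vanishes at S, so domination makes ψ zero on its square, and Cauchy–Schwarz then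
  -- makes ψ zero on the element itself.
  have h0 : (centralMul l f - l S • f) S = 0 := sub_self (l S • f S)
  have h1 : ψ (star (centralMul l f - l S • f) * (centralMul l f - l S • f)) = 0 := by
    have h2 := h (centralMul l f - l S • f)
    have h3 : fiberState S ω (star (centralMul l f - l S • f) * (centralMul l f - l S • f)) = 0 := by
      rw [fiberState_apply, ZeroAtInftyContinuousMap.mul_apply, h0, mul_zero, map_zero]
    rw [h3, Complex.zero_re, mul_zero] at h2
    rw [← hψ.ofReal_re, le_antisymm h2 (hψ.re_nonneg _), Complex.ofReal_zero]
  have h4 := hψ.norm_sq_apply_le (centralMul l f - l S • f)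
  rw [h1, Complex.zero_re, mul_zero] at h4
  have h5 : ψ (centralMul l f - l S • f) = 0 := by
    simpa using le_antisymm h4 (by positivity)
  rw [map_sub, map_smul, sub_eq_zero] at h5
  exact h5

/-- The states over S form a face: the components of a decomposition are dominated by multiples of
the state, hence lie over S too. So extremality in the fibre and in the whole state space agree. -/
theorem fiberState_mem_pureStates_iff {S : X} {ω : StrongDual ℂ (CompactOp H)} :
    fiberState S ω ∈ pureStates (CompactField X H) ↔ ω ∈ pureStates (CompactOp H) := by
  refine and_congr fiberState_mem_stateSpace_iff ⟨fun h ψ hψ χ hχ hseg => ?_,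
    fun h ψ hψ χ hχ hseg => ?_⟩
  · refine fiberState_injective S (h (fiberState_mem_stateSpace_iff.2 hψ)
      ((fiberState_mem_stateSpace_iff (S := S)).2 hχ) ?_)
    obtain ⟨a, b, ha, hb, hab, rfl⟩ := hseg
    exact ⟨a, b, ha, hb, hab, rfl⟩
  · obtain ⟨c, -, hle⟩ := exists_re_apply_le_of_mem_openSegment hχ hseg
    obtain ⟨ψ', rfl⟩ := exists_eq_fiberState_of_le (stateSpace.isPositiveFunctional hψ) hle
    rw [openSegment_symm] at hseg
    obtain ⟨d, -, hle'⟩ := exists_re_apply_le_of_mem_openSegment hψ hseg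
    obtain ⟨χ', rfl⟩ := exists_eq_fiberState_of_le (stateSpace.isPositiveFunctional hχ) hle'
    rw [openSegment_symm] at hseg
    rw [h (fiberState_mem_stateSpace_iff.1 hψ) (fiberState_mem_stateSpace_iff.1 hχ)]
    obtain ⟨a, b, ha, hb, hab, he⟩ := hseg
    exact ⟨a, b, ha, hb, hab, fiberState_injective S he⟩

/-- Every pure state of `C₀(X, 𝒦(H))` lies over a point. -/
theorem pureStates.exists_eq_fiberState {φ : StrongDual ℂ (CompactField X H)}
    (hφ : φ ∈ pureStates (CompactField X H)) : ∃ (S : X) (ω : _), φ = fiberState S ω := by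
  have hφp := stateSpace.isPositiveFunctional hφ.1
  let T : C₀(X, ℂ) →ₗ[ℂ] (CompactField X H →ₗ[ℂ] ℂ) :=
    (centralMulₗ X H).compr₂ φ.toLinearMap
  -- For l = m*m the translate f ↦ φ(l f) is positive and dominated by ‖m‖² φ, so it is a multiple
  -- of φ. Positive elements span `C₀(X)`.
  have hT : ∀ l, T l ∈ Submodule.span ℂ {φ.toLinearMap} := fun l => by
    let _ := CStarAlgebra.spectralOrder C₀(X, ℂ)
    have _ := CStarAlgebra.spectralOrderedRing C₀(X, ℂ)
    have hl : l ∈ Submodule.span ℂ {a : C₀(X, ℂ) | 0 ≤ a} := by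
      rw [CStarAlgebra.span_nonneg]; exact Submodule.mem_top
    refine (Submodule.span_le (p := (Submodule.span ℂ {φ.toLinearMap}).comap T)).2 ?_ hl
    intro a ha
    obtain ⟨m, rfl⟩ := CStarAlgebra.nonneg_iff_eq_star_mul_self.1 (show 0 ≤ a from ha)
    have hpos : IsPositiveFunctional (centralTranslate φ (star m * m)) := fun f => by
      rw [centralTranslate_apply, ← star_centralMul_mul_self]
      exact hφp _
    obtain ⟨r, -, hr⟩ := pureStates.exists_eq_smul_of_le hφ hpos (c := ‖m‖ ^ 2) fun f => by
      obtain ⟨d, hd⟩ := exists_star_mul_self_eq_sub_centralMul m f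
      have h1 := hφp.re_nonneg d
      rw [hd, map_sub, map_smul, Complex.sub_re, smul_eq_mul, Complex.re_ofReal_mul,
        sub_nonneg] at h1
      exact h1
    refine Submodule.mem_span_singleton.2 ⟨(r : ℂ), LinearMap.ext fun f => ?_⟩
    exact (DFunLike.congr_fun hr f).symm
  choose c hc using fun l => Submodule.mem_span_singleton.1 (hT l)
  have hc' : ∀ l f, φ (centralMul l f) = c l * φ f := fun l f =>
    (LinearMap.congr_fun (hc l) f).symm
  have hne : φ ≠ 0 := fun h0 => by
    have h1 := hφ.1.2
    rw [h0, norm_zero] at h1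
    exact zero_ne_one h1
  obtain ⟨S, hS⟩ := exists_point_of_centralMul hne c hc'
  exact ⟨S, _root_.exists_eq_fiberState fun l f => by rw [hc', hS]⟩

theorem point_eq_of_fiberState_eq {S T : X} {ω ω' : StrongDual ℂ (CompactOp H)}
    (hω : ω ∈ stateSpace (CompactOp H)) (h : fiberState S ω = fiberState T ω') : S = T := by
  by_contra hne
  obtain ⟨l, hS, hT⟩ := exists_zeroAtInfty_separating hne
  obtain ⟨f, hf⟩ := stateSpace.exists_apply_ne_zero
    ((fiberState_mem_stateSpace_iff (S := S)).2 hω)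
  have h1 := fiberState_centralMul S ω l f
  rw [h, fiberState_centralMul, hS, hT, zero_mul, one_mul, ← h] at h1
  exact hf h1.symm

/-- The pure states of `C₀(X, 𝒦(H))`. -/
theorem bijOn_fiberState :
    Set.BijOn (fun p : X × StrongDual ℂ (CompactOp H) => fiberState p.1 p.2)
      (Set.univ ×ˢ pureStates (CompactOp H)) (pureStates (CompactField X H)) := by
  refine ⟨fun p hp => fiberState_mem_pureStates_iff.2 hp.2, ?_, fun φ hφ => ?_⟩
  · rintro ⟨S, ω⟩ ⟨-, hω⟩ ⟨T, ω'⟩ - h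
    obtain rfl : S = T := point_eq_of_fiberState_eq hω.1 h
    exact congrArg (Prod.mk S) (fiberState_injective S h)
  · obtain ⟨S, ω, rfl⟩ := pureStates.exists_eq_fiberState hφ
    exact ⟨(S, ω), ⟨trivial, fiberState_mem_pureStates_iff.1 hφ⟩, rfl⟩

end FieldStates

/-! ### Separable pure states and pairs over a common point -/

section SeparableStates

variable {X : Type u} [TopologicalSpace X]
variable {H : Type v} [NormedAddCommGroup H] [InnerProductSpace ℂ H] [CompleteSpace H]

/-- The only constraint that balancing puts on a product functional; it forces the two base points
to coincide. -/
theorem IsTensorOf.centralMul_comm {φ : StrongDual ℂ (BalancedSquare X H)}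
    {φ₁ φ₂ : StrongDual ℂ (CompactField X H)} (h : IsTensorOf φ φ₁ φ₂) (l : C₀(X, ℂ))
    (f g : CompactField X H) : φ₁ (centralMul l f) * φ₂ g = φ₁ f * φ₂ (centralMul l g) := by
  rw [← h, ← h, balancedTmul_act]

/-- States over the same point have a tensor product on the balanced tensor product. -/
theorem exists_isTensorOf_fiberState {S : X} {ω₁ ω₂ : StrongDual ℂ (CompactOp H)}
    (hS₁ : fiberState S ω₁ ∈ stateSpace (CompactField X H))
    (hS₂ : fiberState S ω₂ ∈ stateSpace (CompactField X H)) :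
    ∃ φ ∈ stateSpace (BalancedSquare X H), IsTensorOf φ (fiberState S ω₁) (fiberState S ω₂) := by
  have hz : ∀ (ω : StrongDual ℂ (CompactOp H)) (l : C₀(X, ℂ)) (f : CompactField X H),
      fiberState S ω (star (centralMul l f - l S • f) * (centralMul l f - l S • f)) = 0 :=
    fun ω l f => by
      have h0 : (centralMul l f - l S • f) S = 0 := sub_self (l S • f S)
      rw [fiberState_apply, ZeroAtInftyContinuousMap.mul_apply, h0, mul_zero, map_zero]
  exact exists_mem_stateSpace_isTensorOf centralMul_mul_assoc hS₁ hS₂ (fun l => l S) (hz ω₁) (hz ω₂)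

/-- A tensor product of states determines its factors. -/
theorem IsTensorOf.unique {A : Type u} [NonUnitalCStarAlgebra A] {Z : Type v} {act : Z → A → A}
    {φ : StrongDual ℂ (BalancedTensor act)} {φ₁ φ₂ ψ₁ ψ₂ : StrongDual ℂ A}
    (h : IsTensorOf φ φ₁ φ₂) (h' : IsTensorOf φ ψ₁ ψ₂) (h₁ : φ₁ ∈ stateSpace A)
    (h₂ : φ₂ ∈ stateSpace A) (h₁' : ψ₁ ∈ stateSpace A) (h₂' : ψ₂ ∈ stateSpace A) :
    φ₁ = ψ₁ ∧ φ₂ = ψ₂ := by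
  have hm : ∀ f g, φ₁ f * φ₂ g = ψ₁ f * ψ₂ g := fun f g => by rw [← h, ← h']
  have hp₁ := stateSpace.isPositiveFunctional h₁
  have hp₂ := stateSpace.isPositiveFunctional h₂
  have hp₁' := stateSpace.isPositiveFunctional h₁'
  have hp₂' := stateSpace.isPositiveFunctional h₂'
  obtain ⟨a, ha⟩ := stateSpace.exists_re_apply_star_mul_self_pos h₁
  obtain ⟨b, hb⟩ := stateSpace.exists_re_apply_star_mul_self_pos h₂
  constructor
  -- Fixing the second argument at b*b with φ₂(b*b) > 0 makes φ₁ a nonnegative multiple of ψ₁; both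
  -- have norm one.
  · refine eq_of_eq_smul_of_mem_stateSpace h₁' h₁
      (r := (ψ₂ (star b * b)).re / (φ₂ (star b * b)).re)
      (div_nonneg (hp₂'.re_nonneg b) hb.le) (ContinuousLinearMap.ext fun f => ?_)
    rw [smul_apply, Complex.real_smul, Complex.ofReal_div, hp₂'.ofReal_re, hp₂.ofReal_re,
      div_mul_eq_mul_div, eq_div_iff, hm, mul_comm]
    exact fun h0 => by simp [h0] at hb
  · refine eq_of_eq_smul_of_mem_stateSpace h₂' h₂
      (r := (ψ₁ (star a * a)).re / (φ₁ (star a * a)).re)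
      (div_nonneg (hp₁'.re_nonneg a) ha.le) (ContinuousLinearMap.ext fun g => ?_)
    rw [smul_apply, Complex.real_smul, Complex.ofReal_div, hp₁'.ofReal_re, hp₁.ofReal_re,
      div_mul_eq_mul_div, eq_div_iff, mul_comm (φ₂ g), hm]
    exact fun h0 => by simp [h0] at ha

variable [LocallyCompactSpace X] [T2Space X]

/-- The factors of a separable state lie over a common point. -/
theorem IsTensorOf.exists_eq_fiberState {φ : StrongDual ℂ (BalancedSquare X H)}
    {φ₁ φ₂ : StrongDual ℂ (CompactField X H)} (h : IsTensorOf φ φ₁ φ₂)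
    (h₁ : φ₁ ∈ stateSpace (CompactField X H)) (h₂ : φ₂ ∈ stateSpace (CompactField X H)) :
    ∃ (S : X) (ω₁ ω₂ : StrongDual ℂ (CompactOp H)), φ₁ = fiberState S ω₁ ∧ φ₂ = fiberState S ω₂ := by
  obtain ⟨f₀, hf₀⟩ := stateSpace.exists_apply_ne_zero h₁
  obtain ⟨g₀, hg₀⟩ := stateSpace.exists_apply_ne_zero h₂
  -- Separation of variables: the ratio φ₂(l g₀)/φ₂(g₀) is independent of f, so it is the scalar by
  -- which l acts on φ₁; the next step shows the same for φ₂.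
  have hc₁ : ∀ l f, φ₁ (centralMul l f) = φ₂ (centralMul l g₀) / φ₂ g₀ * φ₁ f := fun l f => by
    rw [div_mul_eq_mul_div, eq_div_iff hg₀, h.centralMul_comm, mul_comm]
  have hc₂ : ∀ l g, φ₂ (centralMul l g) = φ₂ (centralMul l g₀) / φ₂ g₀ * φ₂ g := fun l g => by
    refine mul_left_cancel₀ hf₀ ?_
    rw [← h.centralMul_comm, hc₁]
    ring
  have hne : φ₁ ≠ 0 := fun h0 => hf₀ (by rw [h0, zero_apply])
  obtain ⟨S, hS⟩ := exists_point_of_centralMul hne _ hc₁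
  obtain ⟨ω₁, hω₁⟩ := _root_.exists_eq_fiberState (φ := φ₁) (S := S) fun l f => by rw [hc₁, hS]
  obtain ⟨ω₂, hω₂⟩ := _root_.exists_eq_fiberState (φ := φ₂) (S := S) fun l f => by rw [hc₂, hS]
  exact ⟨S, ω₁, ω₂, hω₁, hω₂⟩

/-- A decomposition of one factor, tensored with the other, decomposes φ. Purity of φ makes that
trivial, and uniqueness of factors brings this back to the fibre. -/
theorem mem_pureStates_of_tensor {φ : StrongDual ℂ (BalancedSquare X H)} {S : X}
    {ω₁ ω₂ : StrongDual ℂ (CompactOp H)} (hφ : φ ∈ pureStates (BalancedSquare X H))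
    (h : IsTensorOf φ (fiberState S ω₁) (fiberState S ω₂))
    (h₁ : ω₁ ∈ stateSpace (CompactOp H)) (h₂ : ω₂ ∈ stateSpace (CompactOp H)) :
    ω₁ ∈ pureStates (CompactOp H) ∧ ω₂ ∈ pureStates (CompactOp H) := by
  have hS : ∀ {ω : StrongDual ℂ (CompactOp H)}, ω ∈ stateSpace (CompactOp H) →
      fiberState S ω ∈ stateSpace (CompactField X H) := fiberState_mem_stateSpace_iff.2
  constructor
  · refine ⟨h₁, fun ψ hψ χ hχ hseg => ?_⟩
    obtain ⟨Ψ, hΨ, hΨt⟩ := exists_isTensorOf_fiberState (hS hψ) (hS h₂)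
    obtain ⟨Χ, hΧ, hΧt⟩ := exists_isTensorOf_fiberState (hS hχ) (hS h₂)
    obtain ⟨a, b, ha, hb, hab, he⟩ := hseg
    have hΨφ : Ψ = φ := hφ.2 hΨ hΧ ⟨a, b, ha, hb, hab,
      BalancedTensor.functional_ext fun f g => by
        rw [add_apply, smul_apply, smul_apply, hΨt, hΧt, h, ← he]
        simp only [fiberState_apply, add_apply, smul_apply, Complex.real_smul]
        ring⟩
    exact fiberState_injective S
      ((hΨφ ▸ hΨt).unique h (hS hψ) (hS h₂) (hS h₁) (hS h₂)).1
  · refine ⟨h₂, fun ψ hψ χ hχ hseg => ?_⟩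
    obtain ⟨Ψ, hΨ, hΨt⟩ := exists_isTensorOf_fiberState (hS h₁) (hS hψ)
    obtain ⟨Χ, hΧ, hΧt⟩ := exists_isTensorOf_fiberState (hS h₁) (hS hχ)
    obtain ⟨a, b, ha, hb, hab, he⟩ := hseg
    have hΨφ : Ψ = φ := hφ.2 hΨ hΧ ⟨a, b, ha, hb, hab,
      BalancedTensor.functional_ext fun f g => by
        rw [add_apply, smul_apply, smul_apply, hΨt, hΧt, h, ← he]
        simp only [fiberState_apply, add_apply, smul_apply, Complex.real_smul]
        ring⟩
    exact fiberState_injective S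
      ((hΨφ ▸ hΨt).unique h (hS h₁) (hS hψ) (hS h₁) (hS h₂)).2

theorem LiesOver.exists_isTensorOf {S : X} {φ₁ φ₂ : StrongDual ℂ (CompactField X H)}
    (h₁ : LiesOver φ₁ S) (h₂ : LiesOver φ₂ S) :
    ∃ φ ∈ pureStates (BalancedSquare X H), IsTensorOf φ φ₁ φ₂ := by
  obtain ⟨ω₁, hω₁, rfl⟩ := h₁
  obtain ⟨ω₂, hω₂, rfl⟩ := h₂
  obtain ⟨φ, hφ, ht⟩ := exists_isTensorOf_fiberState (S := S)
    (fiberState_mem_stateSpace_iff.2 hω₁.1) (fiberState_mem_stateSpace_iff.2 hω₂.1)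
  exact ⟨φ, ht.mem_pureStates hφ (fiberState_mem_pureStates_iff.2 hω₁)
    (fiberState_mem_pureStates_iff.2 hω₂), ht⟩

/-- Tensor products of pure states over different points do not descend. -/
theorem IsTensorOf.point_eq {S T : X} {φ : StrongDual ℂ (BalancedSquare X H)}
    {φ₁ φ₂ : StrongDual ℂ (CompactField X H)} (h : IsTensorOf φ φ₁ φ₂) (h₁ : LiesOver φ₁ S)
    (h₂ : LiesOver φ₂ T) : S = T := by
  obtain ⟨ω₁, hω₁, rfl⟩ := h₁
  obtain ⟨ω₂, hω₂, rfl⟩ := h₂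
  by_contra hne
  obtain ⟨l, hS, hT⟩ := exists_zeroAtInfty_separating hne
  obtain ⟨f, hf⟩ := stateSpace.exists_apply_ne_zero
    ((fiberState_mem_stateSpace_iff (S := S)).2 hω₁.1)
  obtain ⟨g, hg⟩ := stateSpace.exists_apply_ne_zero
    ((fiberState_mem_stateSpace_iff (S := T)).2 hω₂.1)
  have h1 := h.centralMul_comm l f g
  rw [fiberState_centralMul, fiberState_centralMul, hS, hT, one_mul, zero_mul, mul_zero] at h1
  exact mul_ne_zero hf hg h1

variable (X H) in
/-- Separable pure states correspond to pairs of pure states over a common point. -/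
theorem exists_equiv_separable_pureStates :
    ∃ Φ : {p : StrongDual ℂ (CompactField X H) × StrongDual ℂ (CompactField X H) //
          p.1 ∈ pureStates (CompactField X H) ∧ p.2 ∈ pureStates (CompactField X H) ∧
          ∃ S : X, LiesOver p.1 S ∧ LiesOver p.2 S} ≃
        {φ : StrongDual ℂ (BalancedSquare X H) //
          φ ∈ pureStates (BalancedSquare X H) ∧ IsSeparableState φ},
      ∀ p, IsTensorOf (Φ p).1 p.1.1 p.1.2 := by
  have hex : ∀ p : {p : StrongDual ℂ (CompactField X H) × StrongDual ℂ (CompactField X H) //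
      p.1 ∈ pureStates (CompactField X H) ∧ p.2 ∈ pureStates (CompactField X H) ∧
      ∃ S : X, LiesOver p.1 S ∧ LiesOver p.2 S},
      ∃ φ : {φ : StrongDual ℂ (BalancedSquare X H) //
        φ ∈ pureStates (BalancedSquare X H) ∧ IsSeparableState φ},
        IsTensorOf φ.1 p.1.1 p.1.2 := by
    rintro ⟨⟨φ₁, φ₂⟩, h₁, h₂, S, hS₁, hS₂⟩
    obtain ⟨φ, hφ, ht⟩ := hS₁.exists_isTensorOf hS₂
    exact ⟨⟨φ, hφ, φ₁, h₁.1, φ₂, h₂.1, ht⟩, ht⟩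
  choose F hF using hex
  refine ⟨Equiv.ofBijective F ⟨fun p q hpq => ?_, ?_⟩, hF⟩
  · have h := (hF p).unique (hpq ▸ hF q) p.2.1.1 p.2.2.1.1 q.2.1.1 q.2.2.1.1
    exact Subtype.ext (Prod.ext h.1 h.2)
  -- The factors in the definition of separability are arbitrary states; lying over a common point
  -- and being pure are both deduced here.
  · rintro ⟨φ, hφ, φ₁, h₁, φ₂, h₂, ht⟩
    obtain ⟨S, ω₁, ω₂, rfl, rfl⟩ := ht.exists_eq_fiberState h₁ h₂
    obtain ⟨hω₁, hω₂⟩ := mem_pureStates_of_tensor hφ ht (fiberState_mem_stateSpace_iff.1 h₁)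
      (fiberState_mem_stateSpace_iff.1 h₂)
    refine ⟨⟨(fiberState S ω₁, fiberState S ω₂), fiberState_mem_pureStates_iff.2 hω₁,
      fiberState_mem_pureStates_iff.2 hω₂, S, ⟨ω₁, hω₁, rfl⟩, ⟨ω₂, hω₂, rfl⟩⟩, Subtype.ext ?_⟩
    exact BalancedTensor.functional_ext fun f g => (hF _ f g).trans (ht f g).symm

end SeparableStates

theorem mainTheorem8 (X : Type u) [TopologicalSpace X] [LocallyCompactSpace X] [T2Space X]
    (H : Type v) [NormedAddCommGroup H] [InnerProductSpace ℂ H] [CompleteSpace H] :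
    -- the pure states of `E` are the pairs `(ω, δ_S)`, one for each pure state `ω` and point `S`
    Set.BijOn (fun p : X × StrongDual ℂ (CompactOp H) => fiberState p.1 p.2)
      (Set.univ ×ˢ pureStates (CompactOp H)) (pureStates (CompactField X H)) ∧
    -- separable pure states of `E ⊗_{C₀(X)} E` are the pairs of pure states over the same point
    (∃ Φ : {p : StrongDual ℂ (CompactField X H) × StrongDual ℂ (CompactField X H) //
          p.1 ∈ pureStates (CompactField X H) ∧ p.2 ∈ pureStates (CompactField X H) ∧
          ∃ S : X, LiesOver p.1 S ∧ LiesOver p.2 S} ≃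
        {φ : StrongDual ℂ (BalancedSquare X H) //
          φ ∈ pureStates (BalancedSquare X H) ∧ IsSeparableState φ},
      ∀ p, IsTensorOf (Φ p).1 p.1.1 p.1.2) ∧
    -- a simple tensor of pure states over `S` and `T` descends to `E ⊗_{C₀(X)} E` iff `S = T`
    (∀ (S T : X) (φ₁ φ₂ : StrongDual ℂ (CompactField X H)), LiesOver φ₁ S → LiesOver φ₂ T →
      ((∃ φ : StrongDual ℂ (BalancedSquare X H), IsTensorOf φ φ₁ φ₂) ↔ S = T)) := by
  exact ⟨bijOn_fiberState, exists_equiv_separable_pureStates X H, fun S T φ₁ φ₂ h₁ h₂ =>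
    ⟨fun ⟨φ, h⟩ => h.point_eq h₁ h₂, fun h => by
      subst h
      obtain ⟨φ, -, ht⟩ := h₁.exists_isTensorOf h₂
      exact ⟨φ, ht⟩⟩⟩
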